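/- **Setting.** Let $f\ge 2$ be an integer and $l$ an odd prime with $l=ef+1$. Let $K$ be a field with $\operatorname{char}K\nmid f!$, $\operatorname{char}K\nmid l$ and $\operatorname{Gal}(L/K)\simeq(\mathbb Z/l\mathbb Z)^\times=\langle\gamma\rangle$, where $L=K(\zeta_l)$. Put $\beta=\gamma^e$ and let $M=L^{\langle\beta\rangle}$ be the fixed field of $\zeta_l\mapsto\zeta_l^{\beta}$. Subscripts of vectors $\mathbf x=(x_1,\dots,x_{l-1})$ are taken modulo $l$, with $x_0=0$. For $m=1,\dots,e-1$ let $$h_m(\mathbf x)=\sum_{i_0+\beta i_1+\cdots+\beta^{f-1}i_{f-1}\equiv\gamma^m\,(l)}x_{i_0}\cdots x_{i_{f-1}}-\sum_{i_0+\beta i_1+\cdots+\beta^{f-1}i_{f-1}\equiv\gamma^{m+1}\,(l)}x_{i_0}\cdots x_{i_{f-1}},$$ let $V\subset\mathbb A^{l-1}_K$ be the closed subvariety (subscheme) $h_1=\dots=h_{e-1}=0$, and let the $(-1)$-composition be $$(\mathbf x\overset{-1}{\ast}\mathbf y)_k=(-1)^{f-1}\Bigl(\sum_{i=1}^{l-1}x_iy_{k-i}-\sum_{i=1}^{l-1}x_iy_{-i}\Bigr)\qquad(1\le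 k\le l-1).$$ Put $\alpha_{\mathbf x}=(-1)^{f-1}\sum_{i=1}^{l-1}x_i\zeta_l^{\,i}$ and let $W\subset V$ be the open subset where $N_{L/K}(\alpha_{\mathbf x})\ne0$. All of these are understood functorially: for a commutative $K$-algebra $R$, a point of $V(R)$ has coordinates in $R$, $\alpha_{\mathbf x}\in R\otimes_KL$, the norm $N_{L/K}$ is that of $R\otimes_KL$ over $R$, and $\mathbf x\in V(R)$ lies in $W(R)$ if and only if $N_{L/K}(\alpha_{\mathbf x})\in R^\times$. **Theorem.** (a) $W=V^\times$: for every commutative $K$-algebra $R$, a point $\mathbf x\in V(R)$ lies in $W(R)$ if and only if there is $\mathbf y\in V(R)$ with $\mathbf x\overset{-1}{\ast}\mathbf y=\mathbf 1$, where $\mathbf 1=(-1)^f(1,\dots,1)$. The functor $W$ is represented by the finitely generated coordinate ring $\bigl(K[x_1,\dots,x_{l-1}]/(h_1,\dots,h_{e-1})\bigr)[N_{L/K}(\alpha_{\mathbf x})^{-1}]$. (b) Equipped with $\overset{-1}{\ast}$, $W$ is a commutative algebraic $K$-group, and it is isomorphic as an algebraic $K$-group to $$N_{L/M}^{-1}(\mathbb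 G_{m,K})=\{\alpha\in R_{L/K}(\mathbb G_m)\mid N_{L/M}(\alpha)\in\mathbb G_{m,K}\},$$ where $R_{L/K}$ and $R_{M/K}$ denote Weil restriction, $N_{L/M}:R_{L/K}(\mathbb G_m)\to R_{M/K}(\mathbb G_m)$ is the norm, and $\mathbb G_{m,K}\subset R_{M/K}(\mathbb G_m)$ is the diagonal subtorus induced by $K\subset M$. (c) $N_{L/M}^{-1}(\mathbb G_{m,K})$ is an algebraic $K$-torus: it is an algebraic $K$-group, and over any algebraic closure $\overline K$ of $K$ it becomes isomorphic to $\mathbb G_{m,\overline K}^{\,1+e(f-1)}$. -/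

import Mathlib

open CategoryTheory TensorProduct

universe u

noncomputable section

/-! ### Affine algebraic groups and tori, as functors on commutative algebras -/

/-- The `n`-dimensional split torus `𝔾ₘⁿ` over `F`, that is `R ↦ (Rˣ)ⁿ`. -/
def splitTorus (F : Type u) [Field F] (n : ℕ) : CommAlgCat.{u} F ⥤ CommGrpCat.{u} where
  obj R := CommGrpCat.of (Fin n → Rˣ)
  map φ := CommGrpCat.ofHom
    { toFun := fun u i => Units.map (φ.hom : _ →* _) (u i)
      map_one' := by ext; simp
      map_mul' := fun u v => by ext; simp }
  map_id R := by ext; rfl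
  map_comp φ ψ := by ext; rfl

/-- The multiplicative group `𝔾ₘ` over `F`, that is `R ↦ Rˣ`. -/
def multGroup (F : Type u) [Field F] : CommAlgCat.{u} F ⥤ CommGrpCat.{u} where
  obj R := CommGrpCat.of Rˣ
  map φ := CommGrpCat.ofHom (Units.map (φ.hom : _ →* _))
  map_id R := by ext; rfl
  map_comp φ ψ := by ext; rfl

/-- A commutative (affine) algebraic `F`-group: a functor from commutative `F`-algebras to
commutative groups whose underlying set-valued functor is represented by a finitely generated
`F`-algebra, its coordinate ring. -/
def IsAlgebraicGroup {F : Type u} [Field F] (G : CommAlgCat.{u} F ⥤ CommGrpCat.{u}) : Prop :=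
  ∃ A : CommAlgCat.{u} F, Algebra.FiniteType F A ∧
    Nonempty ((G ⋙ forget CommGrpCat.{u}).CorepresentableBy A)

/-- A commutative algebra over an extension `E` of `F`, seen as an `F`-algebra. -/
def restrictBase (F E : Type u) [Field F] [Field E] [Algebra F E] :
    CommAlgCat.{u} E ⥤ CommAlgCat.{u} F where
  obj S := letI := Algebra.compHom S (algebraMap F E); CommAlgCat.of F S
  map {S T} φ :=
    letI := Algebra.compHom S (algebraMap F E)
    letI := Algebra.compHom T (algebraMap F E)
    CommAlgCat.ofHom
      { (φ.hom : S →+* T) with commutes' := fun r => φ.hom.commutes (algebraMap F E r) }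
  map_id _ := rfl
  map_comp _ _ := rfl

/-- The base change `G_E` of an `F`-group functor `G`: on an `E`-algebra `S` it takes the value
`G(S)`. -/
def baseChangeGroup {F : Type u} [Field F] (E : Type u) [Field E] [Algebra F E]
    (G : CommAlgCat.{u} F ⥤ CommGrpCat.{u}) : CommAlgCat.{u} E ⥤ CommGrpCat.{u} :=
  restrictBase F E ⋙ G

/-- `G` is an algebraic `F`-torus of dimension `n`: an algebraic `F`-group that becomes isomorphic
to `𝔾ₘⁿ` over every algebraic closure of `F`. -/
def IsAlgebraicTorus {F : Type u} [Field F] (G : CommAlgCat.{u} F ⥤ CommGrpCat.{u})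
    (n : ℕ) : Prop :=
  IsAlgebraicGroup G ∧
    ∀ (E : Type u) [Field E] [Algebra F E] [IsAlgClosure F E],
      Nonempty (baseChangeGroup E G ≅ splitTorus E n)

/-! ### Norms and base change -/

/-- Norms of finite free algebras commute with base change. Here `c` and `c'` are coordinates of
`B` over `A` and of `B'` over `A'`, with respect to bases that correspond under `h`. -/
theorem norm_map_of_coords {A B A' B' ι : Type*} [CommRing A] [CommRing B] [CommRing A']
    [CommRing B'] [Algebra A B] [Algebra A' B'] [Fintype ι]
    (c : B ≃+ (ι → A)) (hc : ∀ a x i, c (algebraMap A B a * x) i = a * c x i)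
    (c' : B' ≃+ (ι → A')) (hc' : ∀ a x i, c' (algebraMap A' B' a * x) i = a * c' x i)
    (g : A →+* A') (h : B →+* B') (hcc : ∀ x i, c' (h x) i = g (c x i))
    (x : B) : Algebra.norm A' (h x) = g (Algebra.norm A x) := by
  classical
  let b : Module.Basis ι A B := .ofEquivFun
    { c with map_smul' := fun a x => by ext i; simpa [Algebra.smul_def] using hc a x i }
  let b' : Module.Basis ι A' B' := .ofEquivFun
    { c' with map_smul' := fun a x => by ext i; simpa [Algebra.smul_def] using hc' a x i }
  have hr : ∀ y i, b.repr y i = c y i := fun y i => rfl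
  have hr' : ∀ y i, b'.repr y i = c' y i := fun y i => rfl
  have hb : ∀ i, h (b i) = b' i := by
    intro i
    apply b'.repr.injective
    ext j
    rw [hr', hcc, ← hr, b.repr_self, b'.repr_self]
    by_cases hij : i = j
    · subst hij; simp
    · simp [hij]
  rw [Algebra.norm_eq_matrix_det b', Algebra.norm_eq_matrix_det b, RingHom.map_det]
  congr 1
  ext i j
  rw [RingHom.mapMatrix_apply, Matrix.map_apply, Algebra.leftMulMatrix_eq_repr_mul,
    Algebra.leftMulMatrix_eq_repr_mul, hr, hr', ← hcc, map_mul h, hb]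

section Norms

variable {K L : Type u} [Field K] [Field L] [Algebra K L]

/-- The ring map `R ⊗ L → S ⊗ L` induced by an algebra map `R → S`. -/
abbrev tensorMap (L : Type u) [Field L] [Algebra K L] {R S : CommAlgCat.{u} K} (φ : R ⟶ S) :
    R ⊗[K] L →ₐ[K] S ⊗[K] L :=
  Algebra.TensorProduct.map φ.hom (AlgHom.id K L)

/-- The coordinates of `R ⊗ L` over `R ⊗ F`, for a field `F` that acts on `L`, given by a basis of
`L` over `F`. -/
def tensorCoords {F : Type u} [Field F] [Algebra K F] [Algebra F L] [IsScalarTower K F L]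
    {ι : Type*} [Fintype ι] [DecidableEq ι] (b : Module.Basis ι F L)
    (R : Type u) [CommRing R] [Algebra K R] : R ⊗[K] L ≃+ (ι → R ⊗[K] F) :=
  ((LinearEquiv.lTensor R (b.equivFun.restrictScalars K)).trans
    (TensorProduct.piRight K K R (fun _ : ι => F))).toAddEquiv

theorem tensorCoords_tmul {F : Type u} [Field F] [Algebra K F] [Algebra F L] [IsScalarTower K F L]
    {ι : Type*} [Fintype ι] [DecidableEq ι] (b : Module.Basis ι F L)
    (R : Type u) [CommRing R] [Algebra K R] (r : R) (y : L) (i : ι) :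
    tensorCoords (K := K) b R (r ⊗ₜ y) i = r ⊗ₜ b.repr y i := by
  simp [tensorCoords]

theorem norm_tensorMap [FiniteDimensional K L] {R S : CommAlgCat.{u} K} (φ : R ⟶ S)
    (a : R ⊗[K] L) :
    Algebra.norm S (tensorMap L φ a) = φ.hom (Algebra.norm R a) := by
  have h : ∀ R : CommAlgCat.{u} K, ∀ (r : R) (x : R ⊗[K] L) i,
      (Algebra.TensorProduct.basis R (Module.finBasis K L)).repr
        (algebraMap R (R ⊗[K] L) r * x) i =
      r * (Algebra.TensorProduct.basis R (Module.finBasis K L)).repr x i := by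
    intro R r x i
    rw [← Algebra.smul_def, map_smul]
    rfl
  refine norm_map_of_coords
    (Algebra.TensorProduct.basis R (Module.finBasis K L)).equivFun.toAddEquiv (h R)
    (Algebra.TensorProduct.basis S (Module.finBasis K L)).equivFun.toAddEquiv (h S)
    (φ.hom : R →+* S) (tensorMap L φ : R ⊗[K] L →+* S ⊗[K] L) (fun x i => ?_) a
  change (Algebra.TensorProduct.basis S (Module.finBasis K L)).repr (tensorMap L φ x) i =
    φ.hom ((Algebra.TensorProduct.basis R (Module.finBasis K L)).repr x i)
  induction x using TensorProduct.induction_on with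
  | zero => simp
  | add x y hx hy => simp only [map_add, Finsupp.add_apply, hx, hy]
  | tmul r y => simp

/-- For an intermediate field `M` of `L/K`, the ring `R ⊗ L` is an algebra over `R ⊗ M`. -/
abbrev relAlgebra (M : IntermediateField K L) (R : Type u) [CommRing R] [Algebra K R] :
    Algebra (R ⊗[K] M) (R ⊗[K] L) :=
  (Algebra.TensorProduct.map (AlgHom.id K R) M.val).toRingHom.toAlgebra

/-- The norm map `N_{L/M}` on `R`-points: the norm of `R ⊗ L` over `R ⊗ M`. -/
def relNorm (M : IntermediateField K L) (R : Type u) [CommRing R] [Algebra K R] :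
    R ⊗[K] L →* R ⊗[K] M :=
  letI := relAlgebra M R
  Algebra.norm (R ⊗[K] M)

theorem tensorCoords_mul (M : IntermediateField K L) {ι : Type*} [Fintype ι] [DecidableEq ι]
    (b : Module.Basis ι M L) (R : Type u) [CommRing R] [Algebra K R]
    (a : R ⊗[K] M) (x : R ⊗[K] L) (i : ι) :
    tensorCoords (K := K) b R
      (Algebra.TensorProduct.map (AlgHom.id K R) M.val a * x) i =
      a * tensorCoords (K := K) b R x i := by
  induction a using TensorProduct.induction_on with
  | zero => simp
  | add a a' h h' => rw [map_add, add_mul, map_add, Pi.add_apply, h, h', add_mul]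
  | tmul s m =>
    induction x using TensorProduct.induction_on with
    | zero => simp
    | add x x' h h' =>
      rw [mul_add, map_add, Pi.add_apply, h, h', map_add, Pi.add_apply, mul_add]
    | tmul r y =>
      have h : M.val m * y = m • y := rfl
      rw [Algebra.TensorProduct.map_tmul, Algebra.TensorProduct.tmul_mul_tmul, h,
        tensorCoords_tmul, tensorCoords_tmul, Algebra.TensorProduct.tmul_mul_tmul]
      simp

theorem relNorm_tensorMap [FiniteDimensional K L] (M : IntermediateField K L)
    {R S : CommAlgCat.{u} K} (φ : R ⟶ S) (a : R ⊗[K] L) :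
    relNorm M S (tensorMap L φ a) = tensorMap M φ (relNorm M R a) := by
  let := relAlgebra M R
  let := relAlgebra M S
  refine norm_map_of_coords
    (tensorCoords (K := K) (Module.finBasis M L) R) (tensorCoords_mul M _ R)
    (tensorCoords (K := K) (Module.finBasis M L) S) (tensorCoords_mul M _ S)
    (tensorMap M φ).toRingHom
    (tensorMap L φ : R ⊗[K] L →+* S ⊗[K] L) (fun x i => ?_) a
  change tensorCoords (K := K) (Module.finBasis M L) S (tensorMap L φ x) i =
    tensorMap M φ (tensorCoords (K := K) (Module.finBasis M L) R x i)
  induction x using TensorProduct.induction_on with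
  | zero => simp
  | add x y hx hy => simp only [map_add, Pi.add_apply, hx, hy]
  | tmul r y => simp [tensorCoords_tmul]

/-! ### The Weil restriction of `𝔾ₘ` and the subgroup `N_{L/M}⁻¹(𝔾ₘ)` -/

/-- The Weil restriction `R_{L/K}(𝔾ₘ)`, that is `R ↦ (R ⊗ L)ˣ`. -/
def weilGm (K L : Type u) [Field K] [Field L] [Algebra K L] :
    CommAlgCat.{u} K ⥤ CommGrpCat.{u} where
  obj R := CommGrpCat.of (R ⊗[K] L)ˣ
  map φ := CommGrpCat.ofHom (Units.map (tensorMap L φ : _ →* _))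
  map_id R := by
    ext u
    change tensorMap L (𝟙 R) (u : R ⊗[K] L) = u
    simp [tensorMap]
  map_comp {R S T} φ ψ := by
    ext u
    change tensorMap L (φ ≫ ψ) (u : R ⊗[K] L) = tensorMap L ψ (tensorMap L φ (u : R ⊗[K] L))
    rw [← AlgHom.comp_apply, ← Algebra.TensorProduct.map_comp]
    rfl

/-- The norm homomorphism `N_{L/M} : R_{L/K}(𝔾ₘ) → R_{M/K}(𝔾ₘ)`. -/
def relNormHom [FiniteDimensional K L] (M : IntermediateField K L) : weilGm K L ⟶ weilGm K M where
  app R := CommGrpCat.ofHom (Units.map (relNorm M R))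
  naturality R S φ := by
    ext u
    apply Units.ext
    exact relNorm_tensorMap M φ (Units.val (α := R ⊗[K] L) u)

/-- The diagonal embedding `𝔾ₘ → R_{M/K}(𝔾ₘ)`, on `R`-points the inclusion of `Rˣ` in
`(R ⊗ M)ˣ`. -/
def diagHom (M : IntermediateField K L) : multGroup K ⟶ weilGm K M where
  app R := CommGrpCat.ofHom
    (Units.map (Algebra.TensorProduct.includeLeft : R →ₐ[K] R ⊗[K] M) : Rˣ →* (R ⊗[K] M)ˣ)
  naturality R S φ := by
    ext r
    apply Units.ext
    change (φ.hom (Units.val (α := R) r)) ⊗ₜ[K] (1 : M) =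
      tensorMap M φ ((Units.val (α := R) r) ⊗ₜ[K] (1 : M))
    simp

/-- The `R`-points of `N_{L/M}⁻¹(𝔾ₘ)`: the `α` in `R_{L/K}(𝔾ₘ)(R)` with `N_{L/M}(α)` in the image
of `𝔾ₘ(R)`. -/
def normTorusPoints [FiniteDimensional K L] (M : IntermediateField K L) (R : CommAlgCat.{u} K) :
    Subgroup ((weilGm K L).obj R) :=
  (((diagHom M).app R).hom.range).comap ((relNormHom M).app R).hom

theorem map_mem_normTorusPoints [FiniteDimensional K L] (M : IntermediateField K L)
    {R S : CommAlgCat.{u} K} (φ : R ⟶ S) (α : (weilGm K L).obj R)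
    (hα : α ∈ normTorusPoints M R) : (weilGm K L).map φ α ∈ normTorusPoints M S := by
  obtain ⟨r, hr⟩ := hα
  refine ⟨(multGroup K).map φ r, ?_⟩
  have h1 := DFunLike.congr_fun (congrArg CommGrpCat.Hom.hom ((diagHom M).naturality φ)) r
  have h2 := DFunLike.congr_fun (congrArg CommGrpCat.Hom.hom ((relNormHom M).naturality φ)) α
  refine h1.trans (Eq.trans ?_ h2.symm)
  exact congrArg ((weilGm K M).map φ) hr

/-- The `K`-group `N_{L/M}⁻¹(𝔾ₘ) ⊂ R_{L/K}(𝔾ₘ)`. -/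
def normTorus [FiniteDimensional K L] (M : IntermediateField K L) :
    CommAlgCat.{u} K ⥤ CommGrpCat.{u} where
  obj R := CommGrpCat.of (normTorusPoints M R)
  map {R S} φ := CommGrpCat.ofHom
    ((((weilGm K L).map φ).hom.comp (normTorusPoints M R).subtype).codRestrict
      (normTorusPoints M S) (fun α => map_mem_normTorusPoints M φ α.1 α.2))
  map_id R := by
    ext α
    exact DFunLike.congr_fun (congrArg CommGrpCat.Hom.hom ((weilGm K L).map_id R)) α.1
  map_comp {R S T} φ ψ := by
    ext α
    exact DFunLike.congr_fun (congrArg CommGrpCat.Hom.hom ((weilGm K L).map_comp φ ψ)) α.1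

end Norms

/-! ### The varieties `V` and `W` and the compositions -/

/-- The index set `{1, …, l - 1}`, as the nonzero residues modulo `l`. -/
abbrev Idx (l : ℕ) : Type := {i : ZMod l // i ≠ 0}

/-- Extension of a vector `(x₁, …, x_{l-1})` to all subscripts modulo `l`, with `x₀ = 0`. -/
def extZero {l : ℕ} {R : Type*} [Zero R] (x : Idx l → R) (i : ZMod l) : R :=
  if h : i ≠ 0 then x ⟨i, h⟩ else 0

/-- The composition `φ_d`: the vector `x ∗_d y` with entries
`z_k = (-1)^{f-1} (∑_{i≠0} x_{-d⁻¹i} y_{k-i} - ∑_{i≠0} x_{-d⁻¹i} y_{-i})`. -/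
def dComp {l : ℕ} [Fact l.Prime] (f : ℕ) {R : Type*} [CommRing R] (d : (ZMod l)ˣ)
    (x y : Idx l → R) : Idx l → R := fun k =>
  (-1) ^ (f - 1) *
    (∑ i : Idx l, extZero x (-(↑d⁻¹ : ZMod l) * i) * extZero y (k - i) -
      ∑ i : Idx l, extZero x (-(↑d⁻¹ : ZMod l) * i) * extZero y (-(i : ZMod l)))

/-- The vector `𝟏 = (-1)^f (1, …, 1)`. -/
def oneVec (l f : ℕ) (R : Type*) [CommRing R] : Idx l → R := fun _ => (-1) ^ f

section Varieties

variable (K : Type u) [Field K] {L : Type u} [Field L] [Algebra K L]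
  {l : ℕ} [Fact l.Prime] (e f : ℕ) (γ : (ZMod l)ˣ)

/-- The polynomial `∑ x_{i₀} ⋯ x_{i_{f-1}}` over `i₀ + β i₁ + ⋯ + β^{f-1} i_{f-1} ≡ c (mod l)`,
where `β = γ^e`. -/
def corrPoly (c : ZMod l) : MvPolynomial (Idx l) K :=
  ∑ i : Fin f → ZMod l with ∑ j : Fin f, (((γ ^ e) ^ (j : ℕ) : (ZMod l)ˣ) : ZMod l) * i j = c,
    ∏ j : Fin f, extZero (fun k : Idx l => (MvPolynomial.X k : MvPolynomial (Idx l) K)) (i j)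

/-- The form `h_m`. -/
def hPoly (m : ℕ) : MvPolynomial (Idx l) K :=
  corrPoly K e f γ ((γ ^ m : (ZMod l)ˣ) : ZMod l) -
    corrPoly K e f γ ((γ ^ (m + 1) : (ZMod l)ˣ) : ZMod l)

/-- The `R`-points of `V`: the solutions in `R` of `h_m = 0` for `m = 1, …, e - 1`. -/
def VPoints (R : Type u) [CommRing R] [Algebra K R] : Set (Idx l → R) :=
  {x | ∀ m ∈ Finset.Icc 1 (e - 1), MvPolynomial.aeval x (hPoly K e f γ m) = 0}

variable {K} in
/-- `α_x = (-1)^{f-1} ∑ x_i ζ^i`, an element of `R ⊗ L` for `x` with entries in `R`. -/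
def alphaElt (ζ : L) {R : Type u} [CommRing R] [Algebra K R] (x : Idx l → R) : R ⊗[K] L :=
  (-1) ^ (f - 1) * ∑ i : Idx l, x i ⊗ₜ[K] (ζ ^ (i : ZMod l).val)

/-- The `R`-points of the open subset `W` of `V` where `N_{L/K}(α_x)` does not vanish. -/
def WPoints (ζ : L) (R : Type u) [CommRing R] [Algebra K R] : Set (Idx l → R) :=
  {x | x ∈ VPoints K e f γ R ∧ IsUnit (Algebra.norm R (alphaElt (K := K) f ζ x))}

/-- The norm `N_{L/K}(α_x)` as a polynomial in `x₁, …, x_{l-1}`. -/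
def normPoly (ζ : L) : MvPolynomial (Idx l) K :=
  Algebra.norm (MvPolynomial (Idx l) K)
    (alphaElt (K := K) f ζ (fun k : Idx l => (MvPolynomial.X k : MvPolynomial (Idx l) K)))

/-- The coordinate ring of `V`. -/
abbrev coordRingV : Type u :=
  MvPolynomial (Idx l) K ⧸ Ideal.span ((hPoly K e f γ) '' (Finset.Icc 1 (e - 1) : Set ℕ))

/-- The coordinate ring of the principal open subset `W = {N_{L/K}(α_x) ≠ 0}` of `V`. -/
abbrev coordRingW (ζ : L) : Type u :=
  Localization.Away (Ideal.Quotient.mk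
    (Ideal.span ((hPoly K e f γ) '' (Finset.Icc 1 (e - 1) : Set ℕ))) (normPoly K f ζ))

theorem map_mem_VPoints {R S : CommAlgCat.{u} K} (φ : R ⟶ S) {x : Idx l → R}
    (hx : x ∈ VPoints K e f γ R) : (fun i => φ.hom (x i)) ∈ VPoints K e f γ S := by
  intro m hm
  have h := congrArg φ.hom (hx m hm)
  rw [map_zero] at h
  rw [← h]
  exact (MvPolynomial.comp_aeval_apply x φ.hom _).symm

theorem tensorMap_alphaElt (ζ : L) {R S : CommAlgCat.{u} K} (φ : R ⟶ S) (x : Idx l → R) :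
    tensorMap L φ (alphaElt (K := K) f ζ x) = alphaElt f ζ (fun i => φ.hom (x i)) := by
  simp [alphaElt, map_sum]

/-- `W` as a functor on commutative `K`-algebras. -/
def WFunctor [FiniteDimensional K L] (ζ : L) : CommAlgCat.{u} K ⥤ Type u where
  obj R := WPoints K e f γ ζ R
  map φ := ↾fun x => ⟨fun i => φ.hom (x.1 i), map_mem_VPoints K e f γ φ x.2.1, by
    rw [← tensorMap_alphaElt, norm_tensorMap]
    exact x.2.2.map φ.hom⟩
  map_id R := rfl
  map_comp φ ψ := rfl

variable {K}

/-- The field `M = L^{⟨β⟩}`, where `β = γ^e` acts on `L = K(ζ)` by `ζ ↦ ζ^β`. -/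
def fieldM (K : Type u) [Field K] {L : Type u} [Field L] [Algebra K L] {l : ℕ} (e : ℕ)
    (γ : (ZMod l)ˣ) (ζ : L) : IntermediateField K L :=
  IntermediateField.fixedField
    (Subgroup.closure {σ : L ≃ₐ[K] L | σ ζ = ζ ^ ((γ ^ e : (ZMod l)ˣ) : ZMod l).val})

end Varieties

end

/-! ### Norms and conjugates -/

/-! The powers `ζ ^ k` with `k ≠ 0` form a basis of `L/K`, so `x ↦ α_x` identifies vectors over `R`
with `R ⊗ L`. It turns the `(-1)`-composition into multiplication (`alphaElt_mul`) and `𝟏` into `1`.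

The norm `N_{L/M}(α_x)` is the product of the `f` conjugates under powers of `β`. Expanded, it is `∑
P_c ζ ^ c`, where `P_c` is the value at `x` of the correlation sum `corrPoly`
(`prod_conj_alphaElt`). Since `∑ ζ ^ c = 0` is the only linear relation, this is a scalar exactly
when `P_c` is constant for `c ≠ 0`. As `P` is invariant under multiplication by `β`, it suffices to
compare `P` at `γ, …, γ ^ e`, which is what the `h_m` do. Thus `V` is the locus where `N_{L/M}(α)`
is a scalar (`mem_VPoints_iff`), and `W` consists of the units in it, a unit being detected by its
norm.

Over an algebra containing `L`, evaluating all conjugates gives `R ⊗ L ≅ R ^ Gal(L/K)`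
(`conjEval_bijective`). The torus condition then says that the products over the `e` cosets of `⟨β⟩`
agree (`splitEquiv_mem_rowTorus`). The common product and `f - 1` entries in each coset are free
coordinates. -/

theorem Algebra.isUnit_norm_iff_isUnit {A B : Type*} [CommRing A] [CommRing B] [Algebra A B]
    [Module.Free A B] [Module.Finite A B] {b : B} : IsUnit (Algebra.norm A b) ↔ IsUnit b := by
  refine ⟨fun h => ?_, fun h => h.map _⟩
  rw [Algebra.norm_apply, ← LinearMap.isUnit_iff_isUnit_det, Module.End.isUnit_iff] at h
  obtain ⟨c, hc⟩ := h.2 1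
  exact IsUnit.of_mul_eq_one c (by simpa using hc)

/-- By Dedekind's independence of characters: a relation between the rows is a relation between the
`s i` on a basis, hence on all of `L`. -/
theorem isUnit_conjMatrix {F L ι : Type*} [Field F] [Field L] [Algebra F L] [Fintype ι]
    [DecidableEq ι] (s : ι → L →ₐ[F] L) (hs : Function.Injective s) (b : Module.Basis ι F L) :
    IsUnit (Matrix.of fun i k => s i (b k)) := by
  rw [← Matrix.linearIndependent_rows_iff_isUnit, Fintype.linearIndependent_iff]
  intro c hc
  have hinj : Function.Injective fun i => ((s i : L →ₐ[F] L) : L →* L) := fun i j hij =>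
    hs (AlgHom.ext fun x => DFunLike.congr_fun hij x)
  have hli := (linearIndependent_monoidHom L L).comp _ hinj
  rw [Fintype.linearIndependent_iff] at hli
  refine hli c ?_
  have h : (∑ i, c i • (s i).toLinearMap : L →ₗ[F] L) = 0 := by
    refine b.ext fun k => ?_
    simpa using congrFun hc k
  funext x
  simpa using LinearMap.congr_fun h x

theorem norm_eq_det_of_coords {A B ι : Type*} [CommRing A] [CommRing B] [Algebra A B] [Fintype ι]
    [DecidableEq ι] (c : B ≃+ (ι → A)) (hc : ∀ a x i, c (algebraMap A B a * x) i = a * c x i)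
    (v : ι → B) (hv : ∀ i, c (v i) = Pi.single i 1) (x : B) :
    Algebra.norm A x = (Matrix.of fun k i => c (x * v i) k).det := by
  let b : Module.Basis ι A B := .ofEquivFun
    { c with map_smul' := fun a x => by ext i; simpa [Algebra.smul_def] using hc a x i }
  have hr : ∀ y i, b.repr y i = c y i := fun y i => rfl
  have hb : ∀ i, b i = v i := by
    intro i
    apply b.repr.injective
    ext j
    rw [hr (v i), hv, b.repr_self, Finsupp.single_eq_pi_single]
  rw [Algebra.norm_eq_matrix_det b]
  congr 1
  ext k i
  rw [Algebra.leftMulMatrix_eq_repr_mul, hr, hb]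
  rfl

section Conjugates

variable {K L : Type u} [Field K] [Field L] [Algebra K L]

/-- The action on `R ⊗ L` of an endomorphism of `L/K`. -/
abbrev tensorConj (R : Type u) [CommRing R] [Algebra K R] (s : L →ₐ[K] L) :
    R ⊗[K] L →ₐ[R] R ⊗[K] L :=
  Algebra.TensorProduct.map (AlgHom.id R R) s

/-- The inclusion `R ⊗ M → R ⊗ L`. -/
abbrev tensorIncl (M : IntermediateField K L) (R : Type u) [CommRing R] [Algebra K R] :
    R ⊗[K] M →ₐ[R] R ⊗[K] L :=
  Algebra.TensorProduct.map (AlgHom.id R R) M.val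

theorem tensorIncl_injective (M : IntermediateField K L) (R : Type u) [CommRing R] [Algebra K R] :
    Function.Injective (tensorIncl M R) :=
  Module.Flat.lTensor_preserves_injective_linearMap (M := R) M.val.toLinearMap
    M.val.toRingHom.injective

theorem tensorConj_tensorIncl (M : IntermediateField K L) (R : Type u) [CommRing R] [Algebra K R]
    (s : L →ₐ[K] L) (hs : ∀ m ∈ M, s m = m) (a : R ⊗[K] M) :
    tensorConj R s (tensorIncl M R a) = tensorIncl M R a := by
  induction a using TensorProduct.induction_on with
  | zero => simp
  | add a b ha hb => simp only [map_add, ha, hb]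
  | tmul r m => simp [hs m m.2]

theorem sum_tensorCoords (M : IntermediateField K L) {ι : Type*} [Fintype ι] [DecidableEq ι]
    (b : Module.Basis ι M L) (R : Type u) [CommRing R] [Algebra K R] (x : R ⊗[K] L) :
    ∑ k, tensorIncl M R (tensorCoords (K := K) b R x k) * (1 ⊗ₜ b k) = x := by
  induction x using TensorProduct.induction_on with
  | zero => simp
  | add x y hx hy =>
    conv_rhs => rw [← hx, ← hy]
    simp only [map_add, Pi.add_apply, add_mul, Finset.sum_add_distrib]
  | tmul r y =>
    conv_rhs => rw [← b.sum_repr y, TensorProduct.tmul_sum]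
    refine Finset.sum_congr rfl fun k _ => ?_
    rw [tensorCoords_tmul]
    simp [Algebra.smul_def]

theorem relNorm_eq_det (M : IntermediateField K L) {ι : Type*} [Fintype ι] [DecidableEq ι]
    (b : Module.Basis ι M L) (R : Type u) [CommRing R] [Algebra K R] (a : R ⊗[K] L) :
    relNorm M R a =
      (Matrix.of fun k i => tensorCoords (K := K) b R (a * (1 ⊗ₜ b i)) k).det := by
  let := relAlgebra M R
  refine norm_eq_det_of_coords (tensorCoords (K := K) b R) (tensorCoords_mul M b R)
    (fun i => 1 ⊗ₜ b i) (fun i => ?_) a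
  ext j
  rw [tensorCoords_tmul, b.repr_self]
  by_cases hij : i = j
  · subst hij; simp [Algebra.TensorProduct.one_def]
  · simp [Ne.symm hij]

/-- The norm of `R ⊗ L` over `R ⊗ M` is the product of the conjugates. -/
theorem relNorm_eq_prod (M : IntermediateField K L) {ι : Type*} [Fintype ι] [DecidableEq ι]
    (s : ι → L →ₐ[M] L) (hs : Function.Injective s) (b : Module.Basis ι M L)
    (R : Type u) [CommRing R] [Algebra K R] (a : R ⊗[K] L) :
    tensorIncl M R (relNorm M R a) = ∏ i, tensorConj R ((s i).restrictScalars K) a := by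
  let ν : L →+* R ⊗[K] L := (Algebra.TensorProduct.includeRight : L →ₐ[K] R ⊗[K] L).toRingHom
  let D : Matrix ι ι (R ⊗[K] L) := ν.mapMatrix (Matrix.of fun i k => s i (b k))
  have hD : IsUnit D.det := by
    rw [← Matrix.isUnit_iff_isUnit_det]
    exact (isUnit_conjMatrix s hs b).map _
  let T : Matrix ι ι (R ⊗[K] M) :=
    Matrix.of fun k i => tensorCoords (K := K) b R (a * (1 ⊗ₜ b i)) k
  -- Applying each conjugation to the expansion of `a * b j` in the basis diagonalises
  -- multiplication by `a`; the invertible `det D` then cancels from the determinants.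
  have key : D * (tensorIncl M R).toRingHom.mapMatrix T =
      Matrix.diagonal (fun i => tensorConj R ((s i).restrictScalars K) a) * D := by
    ext i j
    rw [Matrix.diagonal_mul, Matrix.mul_apply]
    have h := congrArg (tensorConj R ((s i).restrictScalars K))
      (sum_tensorCoords M b R (a * (1 ⊗ₜ b j)))
    rw [map_mul (tensorConj R _), map_sum] at h
    refine Eq.trans (Finset.sum_congr rfl fun k _ => ?_) (h.trans ?_)
    · rw [map_mul, tensorConj_tensorIncl M R _ (fun m hm => (s i).commutes ⟨m, hm⟩), mul_comm]
      simp [D, ν, T]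
    · simp [D, ν]
  have h := congrArg Matrix.det key
  rw [Matrix.det_mul, Matrix.det_mul, Matrix.det_diagonal, mul_comm] at h
  have h2 := hD.mul_right_cancel h
  rw [← h2, relNorm_eq_det M b]
  exact RingHom.map_det (tensorIncl M R).toRingHom T

end Conjugates

/-! ### The Galois group and the basis of powers of `ζ` -/

section Cyclotomic

variable {K L : Type u} [Field K] [Field L] [Algebra K L] {l : ℕ} [Fact l.Prime] {ζ : L}

/-- The additive character `a ↦ ζ ^ a` of `ℤ/l`. -/
noncomputable def zetaChar (hζ : IsPrimitiveRoot ζ l) : AddChar (ZMod l) L :=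
  AddChar.zmodChar l hζ.pow_eq_one

theorem zetaChar_apply (hζ : IsPrimitiveRoot ζ l) (a : ZMod l) : zetaChar hζ a = ζ ^ a.val :=
  AddChar.zmodChar_apply _ a

theorem zetaChar_one (hζ : IsPrimitiveRoot ζ l) : zetaChar hζ 1 = ζ := by
  rw [zetaChar_apply, ZMod.val_one, pow_one]

theorem sum_zetaChar (hζ : IsPrimitiveRoot ζ l) : ∑ a, zetaChar hζ a = 0 := by
  refine AddChar.sum_eq_zero_of_ne_one fun h => ?_
  have h1 := DFunLike.congr_fun h 1
  rw [zetaChar_one, AddChar.one_apply] at h1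
  exact hζ.ne_one (Fact.out : l.Prime).one_lt h1

theorem sum_eq_add_sum_idx {A : Type*} [AddCommMonoid A] (g : ZMod l → A) :
    ∑ a, g a = g 0 + ∑ k : Idx l, g k := by
  rw [← Finset.add_sum_erase _ g (Finset.mem_univ 0)]
  congr 1
  refine Finset.sum_subtype _ (fun a => ?_) g
  simp

theorem sum_zetaChar_idx (hζ : IsPrimitiveRoot ζ l) :
    ∑ k : Idx l, zetaChar hζ k = -1 := by
  have h := sum_zetaChar hζ
  rw [sum_eq_add_sum_idx, AddChar.map_zero_eq_one] at h
  exact eq_neg_of_add_eq_zero_right h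

theorem card_idx : Fintype.card (Idx l) = l - 1 := by
  rw [Fintype.card_subtype_compl, ZMod.card, Fintype.card_subtype_eq]

theorem card_gal (hGal : Nonempty ((L ≃ₐ[K] L) ≃* (ZMod l)ˣ)) :
    Nat.card (L ≃ₐ[K] L) = l - 1 := by
  rw [Nat.card_congr hGal.some.toEquiv, Nat.card_eq_fintype_card, ZMod.card_units]

variable [IsCyclotomicExtension {l} K L]

/-- All powers of `ζ` span `L`, and `ζ ^ 0` is redundant because it is minus the sum of the others.
-/
theorem span_zetaChar (hζ : IsPrimitiveRoot ζ l) :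
    Submodule.span K (Set.range fun k : Idx l => zetaChar hζ k) = ⊤ := by
  set N := Submodule.span K (Set.range fun k : Idx l => zetaChar hζ k) with hN
  have hmem : ∀ a, zetaChar hζ a ∈ N := by
    intro a
    by_cases ha : a = 0
    · have h : zetaChar hζ a = -∑ k : Idx l, zetaChar hζ k := by
        rw [sum_zetaChar_idx, neg_neg, ha, AddChar.map_zero_eq_one]
      rw [h]
      exact N.neg_mem (N.sum_mem fun k _ => Submodule.subset_span ⟨k, rfl⟩)
    · exact Submodule.subset_span ⟨⟨a, ha⟩, rfl⟩
  rw [eq_top_iff]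
  intro x _
  have hx : x ∈ Algebra.adjoin K {ζ} := by
    rw [IsCyclotomicExtension.adjoin_primitive_root_eq_top hζ]; trivial
  rw [Algebra.adjoin_singleton_eq_range_aeval] at hx
  obtain ⟨p, rfl⟩ := hx
  change Polynomial.aeval ζ p ∈ N
  rw [Polynomial.aeval_eq_sum_range]
  refine N.sum_mem fun n _ => N.smul_mem _ ?_
  have h := hmem (n : ZMod l)
  rwa [zetaChar_apply, ZMod.val_natCast, ← pow_eq_pow_mod n hζ.pow_eq_one] at h

variable (hζ : IsPrimitiveRoot ζ l) (hGal : Nonempty ((L ≃ₐ[K] L) ≃* (ZMod l)ˣ))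

/-- The isomorphism `(ℤ/l)ˣ ≃ Gal(L/K)`, under which `u` acts by `ζ ↦ ζ ^ u`. -/
noncomputable def galEquiv : (ZMod l)ˣ ≃* (L ≃ₐ[K] L) :=
  -- The abstract isomorphism `hGal` contributes only the order of the group: it makes the injective
  -- map `autToPow` surjective.
  (MulEquiv.ofBijective (hζ.autToPow K) ((Nat.bijective_iff_injective_and_card _).2
    ⟨IsPrimitiveRoot.autToPow_injective K hζ, Nat.card_congr hGal.some.toEquiv⟩)).symm

theorem galEquiv_zetaChar (u : (ZMod l)ˣ) (a : ZMod l) :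
    galEquiv hζ hGal u (zetaChar hζ a) = zetaChar hζ (u * a) := by
  obtain ⟨σ, rfl⟩ := (galEquiv hζ hGal).symm.surjective u
  rw [MulEquiv.apply_symm_apply]
  change _ = zetaChar hζ ((hζ.autToPow K σ : (ZMod l)ˣ) * a)
  have h : σ ζ = zetaChar hζ ((hζ.autToPow K σ : (ZMod l)ˣ) : ZMod l) := by
    rw [← hζ.autToPow_spec K σ, zetaChar_apply]
  have h2 : (((hζ.autToPow K σ : (ZMod l)ˣ) : ZMod l) * a) =
      a.val • ((hζ.autToPow K σ : (ZMod l)ˣ) : ZMod l) := by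
    rw [nsmul_eq_mul, ZMod.natCast_zmod_val, mul_comm]
  rw [h2, AddChar.map_nsmul_eq_pow, ← h, zetaChar_apply, map_pow]

theorem galEquiv_zeta (u : (ZMod l)ˣ) : galEquiv hζ hGal u ζ = ζ ^ (u : ZMod l).val := by
  have h := galEquiv_zetaChar hζ hGal u 1
  rwa [zetaChar_one, mul_one, zetaChar_apply] at h

/-- An automorphism is determined by its value at `ζ`, so the generating set in `fieldM` is a
singleton. -/
theorem fieldM_eq (e : ℕ) (γ : (ZMod l)ˣ) :
    fieldM K e γ ζ =
      IntermediateField.fixedField (Subgroup.zpowers (galEquiv hζ hGal (γ ^ e))) := by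
  rw [fieldM, Subgroup.zpowers_eq_closure]
  congr 2
  ext σ
  rw [Set.mem_ofPred_eq, Set.mem_singleton_iff, ← galEquiv_zeta hζ hGal]
  refine ⟨fun h => ?_, fun h => by rw [h]⟩
  obtain ⟨v, rfl⟩ := (galEquiv hζ hGal).surjective σ
  rw [galEquiv_zeta, galEquiv_zeta] at h
  have h2 := hζ.pow_inj (ZMod.val_lt _) (ZMod.val_lt _) h
  rw [Units.ext (ZMod.val_injective l h2)]

/-- The generator `ζ ↦ ζ ^ (γ ^ (e j))` of `Gal(L/M)` to the power `j`, as an `M`-homomorphism. -/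
noncomputable def conjM (e : ℕ) (γ : (ZMod l)ˣ) (j : ℕ) : L →ₐ[fieldM K e γ ζ] L :=
  { (galEquiv hζ hGal ((γ ^ e) ^ j) : L →ₐ[K] L).toRingHom with
    commutes' := fun m => (IntermediateField.mem_fixedField_iff _ _).1
      ((fieldM_eq hζ hGal e γ).le m.2) (galEquiv hζ hGal ((γ ^ e) ^ j)) (by
        rw [map_pow _ (γ ^ e) j]
        exact Subgroup.npow_mem_zpowers _ j) }

theorem conjM_apply (e : ℕ) (γ : (ZMod l)ˣ) (j : ℕ) (x : L) :
    conjM hζ hGal e γ j x = galEquiv hζ hGal ((γ ^ e) ^ j) x := rfl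

variable {e f : ℕ} {γ : (ZMod l)ˣ}

theorem orderOf_gen (hlef : l = e * f + 1) (hγ : ∀ a : (ZMod l)ˣ, a ∈ Subgroup.zpowers γ) :
    orderOf γ = e * f := by
  rw [orderOf_eq_card_of_forall_mem_zpowers hγ, Nat.card_eq_fintype_card, ZMod.card_units, hlef,
    Nat.add_sub_cancel]

theorem orderOf_gen_pow (hlef : l = e * f + 1) (hγ : ∀ a : (ZMod l)ˣ, a ∈ Subgroup.zpowers γ) :
    orderOf (γ ^ e) = f := by
  have he : e ≠ 0 := by
    rintro rfl
    exact (Fact.out : l.Prime).ne_one (by simpa using hlef)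
  rw [orderOf_pow_of_dvd he (by rw [orderOf_gen hlef hγ]; exact dvd_mul_right e f),
    orderOf_gen hlef hγ, Nat.mul_div_cancel_left _ (Nat.pos_of_ne_zero he)]

variable [FiniteDimensional K L]

/-- The basis `ζ, ζ², …, ζ^(l-1)` of `L/K`. -/
noncomputable def zetaBasis : Module.Basis (Idx l) K L :=
  basisOfTopLeSpanOfCardEqFinrank (fun k : Idx l => zetaChar hζ k) (span_zetaChar hζ).ge (by
    have := IsCyclotomicExtension.isGalois {l} K L
    rw [← IsGalois.card_aut_eq_finrank, card_gal hGal, card_idx])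

theorem zetaBasis_apply (k : Idx l) : zetaBasis hζ hGal k = zetaChar hζ k := by
  simp [zetaBasis]

/-- The group `⟨β⟩` has order `f = [L : M]`, so the powers `β ^ j` with `j < f` supply a full set of
distinct `M`-embeddings for `relNorm_eq_prod`. -/
theorem tensorIncl_relNorm (hlef : l = e * f + 1)
    (hγ : ∀ a : (ZMod l)ˣ, a ∈ Subgroup.zpowers γ) (R : Type u) [CommRing R] [Algebra K R]
    (a : R ⊗[K] L) :
    tensorIncl (fieldM K e γ ζ) R (relNorm (fieldM K e γ ζ) R a) =
      ∏ j : Fin f, tensorConj R (galEquiv hζ hGal ((γ ^ e) ^ (j : ℕ))) a := by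
  have hcard : Module.finrank (fieldM K e γ ζ) L = f := by
    rw [fieldM_eq hζ hGal, IntermediateField.finrank_fixedField_eq_card, Nat.card_zpowers,
      MulEquiv.orderOf_eq,
      orderOf_gen_pow hlef hγ]
  refine relNorm_eq_prod (fieldM K e γ ζ) (fun j : Fin f => conjM hζ hGal e γ j) ?_
    ((Module.finBasis _ L).reindex (finCongr hcard)) R a
  intro i j hij
  have h : galEquiv hζ hGal ((γ ^ e) ^ (i : ℕ)) = galEquiv hζ hGal ((γ ^ e) ^ (j : ℕ)) :=
    AlgEquiv.ext fun x => DFunLike.congr_fun hij x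
  have h2 := (galEquiv hζ hGal).injective h
  have ho := orderOf_gen_pow hlef hγ
  exact Fin.ext (pow_injOn_Iio_orderOf (by simp [ho]) (by simp [ho]) h2)

end Cyclotomic

/-! ### The element `α_x` and the equations of `V` -/

section Alpha

variable {K L : Type u} [Field K] [Field L] [Algebra K L] {l : ℕ} [Fact l.Prime] {ζ : L}
  {R : Type u} [CommRing R] [Algebra K R]

omit [Fact l.Prime] in
theorem extZero_coe {A : Type*} [Zero A] (x : Idx l → A) (k : Idx l) :
    extZero x (k : ZMod l) = x k := by
  simp [extZero, k.2]

theorem extZero_zero {A : Type*} [Zero A] (x : Idx l → A) : extZero x 0 = 0 := by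
  simp [extZero]

theorem map_sum_zetaChar (hζ : IsPrimitiveRoot ζ l) {ι : Type*} (s : Finset ι) (g : ι → ZMod l) :
    zetaChar hζ (∑ j ∈ s, g j) = ∏ j ∈ s, zetaChar hζ (g j) := by
  classical
  induction s using Finset.induction_on with
  | empty => simp
  | insert j s hj ih =>
    simp [Finset.sum_insert hj, Finset.prod_insert hj, AddChar.map_add_eq_mul, ih]

/-- Replacing `ζ ^ 0` by minus the sum of the other powers passes to coordinates in the basis. This
is the source of the subtracted sum in the composition. -/
theorem sum_tmul_zetaChar (hζ : IsPrimitiveRoot ζ l) (g : ZMod l → R) :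
    ∑ a, g a ⊗ₜ[K] zetaChar hζ a = ∑ k : Idx l, (g k - g 0) ⊗ₜ[K] zetaChar hζ k := by
  rw [sum_eq_add_sum_idx]
  simp only [sub_tmul, Finset.sum_sub_distrib]
  rw [← tmul_sum, sum_zetaChar_idx, tmul_neg, sub_neg_eq_add, add_comm, AddChar.map_zero_eq_one]

theorem alphaElt_eq_sum (f : ℕ) (hζ : IsPrimitiveRoot ζ l) (x : Idx l → R) :
    alphaElt (K := K) f ζ x = (-1) ^ (f - 1) * ∑ a, extZero x a ⊗ₜ[K] zetaChar hζ a := by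
  rw [sum_tmul_zetaChar]
  simp only [extZero_coe, extZero_zero, sub_zero, zetaChar_apply]
  rfl

theorem alphaElt_oneVec {f : ℕ} (hf : f ≠ 0) (hζ : IsPrimitiveRoot ζ l) :
    alphaElt (K := K) f ζ (oneVec l f R) = 1 := by
  obtain ⟨n, rfl⟩ := Nat.exists_eq_succ_of_ne_zero hf
  have h : ∑ k : Idx l, oneVec l n.succ R k ⊗ₜ[K] (ζ ^ (k : ZMod l).val) =
      (-1 : R) ^ n.succ • ((1 : R) ⊗ₜ[K] (-1 : L)) := by
    rw [← sum_zetaChar_idx hζ, tmul_sum, Finset.smul_sum]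
    refine Finset.sum_congr rfl fun k _ => ?_
    rw [smul_tmul', smul_eq_mul, mul_one, zetaChar_apply]
    rfl
  rw [alphaElt, h, tmul_neg, ← Algebra.TensorProduct.one_def, Algebra.smul_def, map_pow, map_neg,
    map_one, Nat.succ_sub_one, Nat.succ_eq_add_one]
  have h2 : ((-1 : R ⊗[K] L) ^ n) * (-1) ^ n = 1 := by rw [← mul_pow]; simp
  linear_combination h2

/-- The product of the two sums has the cyclic convolution as coefficients; eliminating `ζ ^ 0`
subtracts the convolution at `0`. Of the two signs `(-1) ^ (f - 1)`, one is that of `α` and the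
other that of the composition. -/
theorem alphaElt_mul (f : ℕ) (hζ : IsPrimitiveRoot ζ l) (x y : Idx l → R) :
    alphaElt (K := K) f ζ (dComp f (-1) x y) = alphaElt f ζ x * alphaElt f ζ y := by
  have h : (∑ a, extZero x a ⊗ₜ[K] zetaChar hζ a) * (∑ a, extZero y a ⊗ₜ[K] zetaChar hζ a) =
      ∑ c, (∑ i : Idx l, x i * extZero y (c - i)) ⊗ₜ[K] zetaChar hζ c := by
    simp_rw [sum_tmul, Finset.sum_mul]
    rw [sum_eq_add_sum_idx, extZero_zero, zero_tmul, zero_mul, zero_add, Finset.sum_comm]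
    refine Finset.sum_congr rfl fun i _ => ?_
    rw [Finset.mul_sum, ← Equiv.sum_comp (Equiv.subRight (i : ZMod l))]
    refine Finset.sum_congr rfl fun c _ => ?_
    rw [Algebra.TensorProduct.tmul_mul_tmul, ← AddChar.map_add_eq_mul, extZero_coe]
    simp
  rw [sum_tmul_zetaChar hζ fun c => ∑ i : Idx l, x i * extZero y (c - i)] at h
  rw [alphaElt_eq_sum f hζ x, alphaElt_eq_sum f hζ y, mul_mul_mul_comm, h, alphaElt, mul_assoc]
  congr 1
  rw [Finset.mul_sum]
  refine Finset.sum_congr rfl fun k _ => ?_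
  have h1 : ((-1 : R ⊗[K] L) ^ (f - 1)) = algebraMap R _ ((-1) ^ (f - 1)) := by
    rw [map_pow, map_neg, map_one]
  rw [h1, ← Algebra.smul_def, smul_tmul', zetaChar_apply, dComp]
  simp [extZero_coe, mul_sub]

variable [FiniteDimensional K L] [IsCyclotomicExtension {l} K L]
  (hζ : IsPrimitiveRoot ζ l) (hGal : Nonempty ((L ≃ₐ[K] L) ≃* (ZMod l)ˣ))

theorem sum_tmul_zetaChar_eq_equivFun_symm (v : Idx l → R) :
    ∑ k : Idx l, v k ⊗ₜ[K] zetaChar hζ k =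
      (Algebra.TensorProduct.basis R (zetaBasis hζ hGal)).equivFun.symm v := by
  rw [Module.Basis.equivFun_symm_apply]
  refine Finset.sum_congr rfl fun k _ => ?_
  rw [Algebra.TensorProduct.basis_apply, zetaBasis_apply, smul_tmul', smul_eq_mul, mul_one]

include hζ hGal in
theorem alphaElt_bijective (f : ℕ) :
    Function.Bijective (alphaElt (K := K) f ζ : (Idx l → R) → R ⊗[K] L) := by
  have h : (alphaElt (K := K) f ζ : (Idx l → R) → R ⊗[K] L) = fun x =>
      ((-1 : (R ⊗[K] L)ˣ) ^ (f - 1)) •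
        (Algebra.TensorProduct.basis R (zetaBasis hζ hGal)).equivFun.symm x := by
    funext x
    rw [← sum_tmul_zetaChar_eq_equivFun_symm, alphaElt, Units.smul_def]
    simp [zetaChar_apply]
  rw [h]
  exact (MulAction.bijective _).comp (LinearEquiv.bijective _)

/-- Vectors with entries in `R` correspond to elements of `R ⊗ L` by `x ↦ α_x`. -/
noncomputable def alphaEquiv (f : ℕ) (R : Type u) [CommRing R] [Algebra K R] :
    (Idx l → R) ≃ R ⊗[K] L :=
  Equiv.ofBijective _ (alphaElt_bijective hζ hGal f)

variable {e f : ℕ} {γ : (ZMod l)ˣ}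

theorem aeval_corrPoly (c : ZMod l) (x : Idx l → R) :
    MvPolynomial.aeval x (corrPoly K e f γ c) =
      ∑ i : Fin f → ZMod l with
        ∑ j : Fin f, (((γ ^ e) ^ (j : ℕ) : (ZMod l)ˣ) : ZMod l) * i j = c,
        ∏ j : Fin f, extZero x (i j) := by
  rw [corrPoly, map_sum]
  refine Finset.sum_congr rfl fun i _ => ?_
  rw [map_prod]
  refine Finset.prod_congr rfl fun j _ => ?_
  unfold extZero
  split <;> simp

omit [FiniteDimensional K L] in
-- Choosing the index `i j` in the conjugate by `β ^ j` produces the exponent `∑ β ^ j * i j`; the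
-- terms are grouped by this exponent. The signs vanish because `(f - 1) * f` is even.
theorem prod_conj_alphaElt (x : Idx l → R) :
    ∏ j : Fin f, tensorConj R (galEquiv hζ hGal ((γ ^ e) ^ (j : ℕ))) (alphaElt (K := K) f ζ x) =
      ∑ c, MvPolynomial.aeval x (corrPoly K e f γ c) ⊗ₜ[K] zetaChar hζ c := by
  have hs : ∀ s : L →ₐ[K] L, tensorConj R s ((-1) ^ (f - 1)) = (-1) ^ (f - 1) := fun s => by
    rw [map_pow, map_neg, map_one]
  simp_rw [alphaElt_eq_sum f hζ x, map_mul, map_sum, Finset.prod_mul_distrib, hs,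
    Finset.prod_const, Finset.card_univ, Fintype.card_fin]
  rw [← pow_mul, Even.neg_one_pow (by rw [mul_comm]; exact Nat.even_mul_pred_self f), one_mul,
    Finset.prod_univ_sum, Fintype.piFinset_univ,
    ← Finset.sum_fiberwise _ (fun i : Fin f → ZMod l =>
      ∑ j : Fin f, (((γ ^ e) ^ (j : ℕ) : (ZMod l)ˣ) : ZMod l) * i j)]
  refine Finset.sum_congr rfl fun c _ => ?_
  rw [aeval_corrPoly, sum_tmul]
  refine Finset.sum_congr rfl fun i hi => ?_
  rw [← (Finset.mem_filter.1 hi).2, map_sum_zetaChar]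
  simp only [Algebra.TensorProduct.map_tmul, AlgHom.id_apply]
  have hp : ∀ (s : Finset (Fin f)) (a : Fin f → R) (b : Fin f → L),
      ∏ j ∈ s, a j ⊗ₜ[K] b j = (∏ j ∈ s, a j) ⊗ₜ[K] ∏ j ∈ s, b j := by
    intro s a b
    classical
    induction s using Finset.induction_on with
    | empty => simp [Algebra.TensorProduct.one_def]
    | insert j s hj ih => simp [Finset.prod_insert hj, ih]
  rw [hp]
  congr 1
  exact Finset.prod_congr rfl fun j _ => galEquiv_zetaChar hζ hGal _ _

include hGal in
theorem sum_tmul_zetaChar_inj (g h : ZMod l → R) :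
    ∑ a, g a ⊗ₜ[K] zetaChar hζ a = ∑ a, h a ⊗ₜ[K] zetaChar hζ a ↔
      ∀ a ≠ 0, g a - g 0 = h a - h 0 := by
  rw [sum_tmul_zetaChar, sum_tmul_zetaChar, sum_tmul_zetaChar_eq_equivFun_symm hζ hGal,
    sum_tmul_zetaChar_eq_equivFun_symm hζ hGal, EmbeddingLike.apply_eq_iff_eq, funext_iff]
  exact Subtype.forall

include hζ hGal in
-- Both sides say that the coefficients `P c` of the norm agree for all `c ≠ 0`; the finitely many
-- equations suffice by `β`-invariance.
theorem mem_VPoints_iff (hlef : l = e * f + 1)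
    (hγ : ∀ a : (ZMod l)ˣ, a ∈ Subgroup.zpowers γ) (x : Idx l → R) :
    x ∈ VPoints K e f γ R ↔
      ∃ r : R, relNorm (fieldM K e γ ζ) R (alphaElt f ζ x) = r ⊗ₜ 1 := by
  set P : ZMod l → R := fun c => MvPolynomial.aeval x (corrPoly K e f γ c) with hP
  have hN : tensorIncl (fieldM K e γ ζ) R (relNorm (fieldM K e γ ζ) R (alphaElt f ζ x)) =
      ∑ c, P c ⊗ₜ[K] zetaChar hζ c := by
    rw [tensorIncl_relNorm hζ hGal hlef hγ, prod_conj_alphaElt]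
  have hr : ∀ r : R, tensorIncl (fieldM K e γ ζ) R (r ⊗ₜ 1) =
      ∑ c : ZMod l, (if c = 0 then r else 0) ⊗ₜ[K] zetaChar hζ c := by
    intro r
    rw [Finset.sum_eq_single 0 (fun b _ hb => by simp [hb]) (by simp)]
    simp
  have hex : (∃ r : R, relNorm (fieldM K e γ ζ) R (alphaElt f ζ x) = r ⊗ₜ 1) ↔
      ∃ r : R, ∀ a ≠ 0, P a - P 0 = -r := by
    refine exists_congr fun r => ?_
    rw [← (tensorIncl_injective (fieldM K e γ ζ) R).eq_iff, hN, hr,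
      sum_tmul_zetaChar_inj hζ hGal]
    refine forall₂_congr fun a ha => ?_
    simp [ha]
  -- The norm lies in `R ⊗ M`, so it is fixed by `ζ ↦ ζ ^ β`, which permutes the coefficients. The
  -- coefficient at `0` stays in place, so comparing coordinates gives equality of coefficients.
  have hper : ∀ c, P (((γ ^ e : (ZMod l)ˣ) : ZMod l) * c) = P c := by
    have h1 := tensorConj_tensorIncl (fieldM K e γ ζ) R
      ((conjM hζ hGal e γ 1).restrictScalars K)
      (fun m hm => (conjM hζ hGal e γ 1).commutes ⟨m, hm⟩)
      (relNorm (fieldM K e γ ζ) R (alphaElt f ζ x))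
    rw [hN, map_sum] at h1
    have h2 : ∀ c, tensorConj R ((conjM hζ hGal e γ 1).restrictScalars K)
        (P c ⊗ₜ[K] zetaChar hζ c) =
        P c ⊗ₜ[K] zetaChar hζ (((γ ^ e : (ZMod l)ˣ) : ZMod l) * c) := by
      intro c
      rw [Algebra.TensorProduct.map_tmul, AlgHom.restrictScalars_apply, conjM_apply, pow_one,
        galEquiv_zetaChar]
      rfl
    have h3 : ∑ c, P c ⊗ₜ[K] zetaChar hζ (((γ ^ e : (ZMod l)ˣ) : ZMod l) * c) =
        ∑ c, P ((((γ ^ e)⁻¹ : (ZMod l)ˣ) : ZMod l) * c) ⊗ₜ[K] zetaChar hζ c :=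
      Fintype.sum_equiv (Units.mulLeft (γ ^ e)) _ _ fun c => by
        rw [Units.mulLeft_apply, Units.inv_mul_cancel_left]
    rw [Finset.sum_congr rfl fun c _ => h2 c, h3, sum_tmul_zetaChar_inj hζ hGal] at h1
    intro c
    by_cases hc : c = 0
    · rw [hc, mul_zero]
    · have h4 := h1 (((γ ^ e : (ZMod l)ˣ) : ZMod l) * c) (mul_ne_zero (Units.ne_zero _) hc)
      rw [Units.inv_mul_cancel_left, mul_zero, sub_left_inj] at h4
      exact h4.symm
  have he : e ≠ 0 := by
    rintro rfl
    exact (Fact.out : l.Prime).ne_one (by simpa using hlef)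
  have hV : x ∈ VPoints K e f γ R ↔ ∀ m ∈ Finset.Icc 1 (e - 1),
      P ((γ ^ m : (ZMod l)ˣ) : ZMod l) = P ((γ ^ (m + 1) : (ZMod l)ˣ) : ZMod l) :=
    forall₂_congr fun m _ => by rw [hPoly, map_sub, sub_eq_zero]
  rw [hV, hex]
  constructor
  · intro h
    -- The `h_m` link the exponents `1, …, e`; beyond that, periodicity lowers the exponent by `e`.
    have hn : ∀ n : ℕ, P ((γ ^ (n + 1) : (ZMod l)ˣ) : ZMod l) = P (γ : ZMod l) := by
      intro n
      induction n using Nat.strong_induction_on with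
      | _ n ih =>
        by_cases hne : n < e
        · rcases n with _ | n
          · simp
          · rw [← h (n + 1) (Finset.mem_Icc.2 ⟨by omega, by omega⟩), ih n (by omega)]
        · rw [← ih (n - e) (by omega), ← hper ((γ ^ (n - e + 1) : (ZMod l)ˣ) : ZMod l),
            ← Units.val_mul, ← pow_add]
          rw [show e + (n - e + 1) = n + 1 by omega]
    refine ⟨P 0 - P (γ : ZMod l), fun a ha => ?_⟩
    -- Dividing by `γ` first gives `a` a positive exponent, since the chain of equations starts at
    -- `γ ^ 1`.
    obtain ⟨n, hn'⟩ := mem_powers_iff_mem_zpowers.2 (hγ (Units.mk0 a ha * γ⁻¹))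
    have ha' : a = ((γ ^ (n + 1) : (ZMod l)ˣ) : ZMod l) := by
      rw [pow_succ, show γ ^ n = _ from hn']
      simp
    rw [ha', hn, neg_sub]
  · rintro ⟨r, hr⟩ m -
    have h1 := hr _ (Units.ne_zero (γ ^ m))
    have h2 := hr _ (Units.ne_zero (γ ^ (m + 1)))
    exact sub_left_injective (h1.trans h2.symm)

end Alpha

/-! ### Points of `W` as points of the norm torus -/

section Points

variable {K L : Type u} [Field K] [Field L] [Algebra K L] [FiniteDimensional K L]

/-- The norm of a scalar `r` is a power of `r`, with positive exponent because the basis is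
nonempty. -/
theorem isUnit_of_isUnit_algebraMap {A B ι : Type*} [CommRing A] [CommRing B] [Algebra A B]
    [Fintype ι] [Nonempty ι] (b : Module.Basis ι A B) {r : A} (h : IsUnit (algebraMap A B r)) :
    IsUnit r := by
  have h2 := h.map (Algebra.norm A)
  rw [Algebra.norm_algebraMap_of_basis b] at h2
  exact (isUnit_pow_iff Fintype.card_ne_zero).1 h2

theorem isUnit_of_relNorm_eq (M : IntermediateField K L) (R : Type u) [CommRing R] [Algebra K R]
    {a : R ⊗[K] L} (ha : IsUnit a) {r : R} (h : relNorm M R a = r ⊗ₜ 1) : IsUnit r := by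
  have h1 : IsUnit (relNorm M R a) := ha.map (relNorm M R)
  rw [h] at h1
  have : Nonempty (Fin (Module.finrank K M)) := Fin.pos_iff_nonempty.1 Module.finrank_pos
  let b : Module.Basis (Fin (Module.finrank K M)) R (R ⊗[K] M) :=
    Algebra.TensorProduct.basis R (Module.finBasis K M)
  refine isUnit_of_isUnit_algebraMap (B := R ⊗[K] M) b ?_
  exact h1

/-- A scalar that is the norm of a unit is itself a unit, so membership in `𝔾ₘ` asks only that the
norm be scalar. -/
theorem mem_normTorusPoints_iff (M : IntermediateField K L) (R : CommAlgCat.{u} K)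
    (u : (R ⊗[K] L)ˣ) :
    (show (weilGm K L).obj R from u) ∈ normTorusPoints M R ↔
      ∃ r : R, relNorm M R (u : R ⊗[K] L) = r ⊗ₜ 1 := by
  constructor
  · rintro ⟨r, hr⟩
    exact ⟨Units.val (α := R) r, (congrArg (Units.val (α := R ⊗[K] M)) hr).symm⟩
  · rintro ⟨r, hr⟩
    exact ⟨(isUnit_of_relNorm_eq M R u.isUnit hr).unit, Units.ext hr.symm⟩

variable {l e f : ℕ} [Fact l.Prime] {ζ : L} {γ : (ZMod l)ˣ} [IsCyclotomicExtension {l} K L]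
  (hζ : IsPrimitiveRoot ζ l) (hGal : Nonempty ((L ≃ₐ[K] L) ≃* (ZMod l)ˣ))
  (hlef : l = e * f + 1) (hγ : ∀ a : (ZMod l)ˣ, a ∈ Subgroup.zpowers γ)

include hζ hGal hlef hγ in
theorem mem_WPoints_iff {R : Type u} [CommRing R] [Algebra K R] (x : Idx l → R) :
    x ∈ WPoints K e f γ ζ R ↔ IsUnit (alphaElt (K := K) f ζ x) ∧
      ∃ r : R, relNorm (fieldM K e γ ζ) R (alphaElt f ζ x) = r ⊗ₜ 1 := by
  rw [← mem_VPoints_iff hζ hGal hlef hγ, and_comm, ← Algebra.isUnit_norm_iff_isUnit (A := R)]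
  rfl

include hζ hGal hlef hγ in
/-- `W` consists of the points of `V` that are invertible for the `(-1)`-composition. -/
theorem mem_WPoints_iff_exists_inverse (hf : f ≠ 0) {R : Type u} [CommRing R] [Algebra K R]
    (x : Idx l → R) : x ∈ WPoints K e f γ ζ R ↔
      x ∈ VPoints K e f γ R ∧ ∃ y ∈ VPoints K e f γ R, dComp f (-1) x y = oneVec l f R := by
  constructor
  · intro hx
    refine ⟨hx.1, ?_⟩
    obtain ⟨⟨u, hu⟩, r, hr⟩ := (mem_WPoints_iff hζ hGal hlef hγ x).1 hx
    -- The inverse vector is the `y` with `α_y = α_x⁻¹`; its relative norm is the inverse of a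
    -- scalar unit, so it again lies in `V`.
    obtain ⟨y, hy⟩ := (alphaElt_bijective hζ hGal f).2 (↑u⁻¹ : R ⊗[K] L)
    obtain ⟨s, rfl⟩ := isUnit_of_relNorm_eq _ R (hu ▸ u.isUnit) hr
    refine ⟨y, ?_, ?_⟩
    · rw [mem_VPoints_iff hζ hGal hlef hγ]
      refine ⟨↑s⁻¹, ?_⟩
      have h1 : relNorm (fieldM K e γ ζ) R (alphaElt f ζ x) *
          relNorm (fieldM K e γ ζ) R (alphaElt f ζ y) = 1 := by
        rw [← map_mul, ← hu, hy, Units.mul_inv, map_one]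
      rw [hr] at h1
      refine left_inv_eq_right_inv ?_ h1 |>.symm
      rw [Algebra.TensorProduct.tmul_mul_tmul, Units.inv_mul, one_mul,
        Algebra.TensorProduct.one_def]
    · apply (alphaElt_bijective (R := R) hζ hGal f).1
      rw [alphaElt_mul f hζ, alphaElt_oneVec hf hζ, hy, ← hu, Units.mul_inv]
  · rintro ⟨hx, y, -, hxy⟩
    refine ⟨hx, Algebra.isUnit_norm_iff_isUnit.2 (IsUnit.of_mul_eq_one (alphaElt f ζ y) ?_)⟩
    rw [← alphaElt_mul f hζ, hxy, alphaElt_oneVec hf hζ]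

/-- The points of `W` are those of `N_{L/M}⁻¹(𝔾ₘ)`, by `x ↦ α_x`. -/
noncomputable def torusEquivW (R : CommAlgCat.{u} K) :
    normTorusPoints (fieldM K e γ ζ) R ≃ WPoints K e f γ ζ R where
  toFun u := ⟨(alphaEquiv hζ hGal f R).symm (Units.val (α := R ⊗[K] L) u.1), by
    have h : alphaElt f ζ ((alphaEquiv hζ hGal f R).symm (Units.val (α := R ⊗[K] L) u.1)) =
        Units.val (α := R ⊗[K] L) u.1 := (alphaEquiv hζ hGal f R).apply_symm_apply _
    rw [mem_WPoints_iff hζ hGal hlef hγ, h]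
    exact ⟨Units.isUnit (M := R ⊗[K] L) u.1,
      (mem_normTorusPoints_iff (fieldM K e γ ζ) R u.1).1 u.2⟩⟩
  invFun x := ⟨((mem_WPoints_iff hζ hGal hlef hγ x.1).1 x.2).1.unit,
    (mem_normTorusPoints_iff (fieldM K e γ ζ) R _).2
      ((mem_WPoints_iff hζ hGal hlef hγ x.1).1 x.2).2⟩
  left_inv u := by
    apply Subtype.ext
    apply Units.ext
    exact (alphaEquiv hζ hGal f R).apply_symm_apply _
  right_inv x := by
    apply Subtype.ext
    exact (alphaEquiv hζ hGal f R).symm_apply_apply _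

theorem alphaElt_torusEquivW (R : CommAlgCat.{u} K) (u : normTorusPoints (fieldM K e γ ζ) R) :
    alphaElt f ζ (torusEquivW hζ hGal hlef hγ R u).1 = Units.val (α := R ⊗[K] L) u.1 :=
  (alphaEquiv hζ hGal f R).apply_symm_apply _

/-- The isomorphism of set-valued functors `N_{L/M}⁻¹(𝔾ₘ) ≅ W`. -/
noncomputable def torusIsoW :
    (normTorus (fieldM K e γ ζ) ⋙ forget CommGrpCat.{u}) ≅ WFunctor K e f γ ζ :=
  NatIso.ofComponents (fun R => (torusEquivW hζ hGal hlef hγ R).toIso) (by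
    intro R S φ
    ext u
    apply Subtype.ext
    apply (alphaElt_bijective (R := S) hζ hGal f).1
    refine (alphaElt_torusEquivW hζ hGal hlef hγ S _).trans ?_
    refine Eq.trans ?_ (tensorMap_alphaElt K f ζ φ (torusEquivW hζ hGal hlef hγ R u).1)
    exact congrArg (tensorMap L φ) (alphaElt_torusEquivW hζ hGal hlef hγ R u).symm)

theorem torusIsoW_mul (R : CommAlgCat.{u} K) (a b : (normTorus (fieldM K e γ ζ)).obj R) :
    ((torusIsoW hζ hGal hlef hγ).hom.app R (a * b : (normTorus (fieldM K e γ ζ)).obj R)).1 =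
      dComp f (-1) ((torusIsoW hζ hGal hlef hγ).hom.app R a).1
        ((torusIsoW hζ hGal hlef hγ).hom.app R b).1 := by
  apply (alphaElt_bijective (R := R) hζ hGal f).1
  rw [alphaElt_mul f hζ]
  refine (alphaElt_torusEquivW hζ hGal hlef hγ R _).trans ?_
  refine Eq.trans ?_ (congrArg₂ (· * ·) (alphaElt_torusEquivW hζ hGal hlef hγ R a)
    (alphaElt_torusEquivW hζ hGal hlef hγ R b)).symm
  rfl

end Points

/-! ### The coordinate ring of `W` -/

section Representability

variable (K : Type u) [Field K] {L : Type u} [Field L] [Algebra K L] [FiniteDimensional K L]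
  {l : ℕ} [Fact l.Prime] (e f : ℕ) (γ : (ZMod l)ˣ) (ζ : L)

/-- The norm commutes with the base change that specialises the generic vector to `x`. -/
theorem aeval_normPoly {R : CommAlgCat.{u} K} (x : Idx l → R) :
    MvPolynomial.aeval x (normPoly K f ζ) = Algebra.norm R (alphaElt (K := K) f ζ x) := by
  let φ : CommAlgCat.of K (MvPolynomial (Idx l) K) ⟶ R := CommAlgCat.ofHom (MvPolynomial.aeval x)
  have h := norm_tensorMap φ (alphaElt (K := K) f ζ
    (fun k : Idx l => (MvPolynomial.X k : MvPolynomial (Idx l) K)))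
  refine h.symm.trans ?_
  rw [tensorMap_alphaElt]
  congr 2
  funext i
  exact MvPolynomial.aeval_X x i

/-- The map from the polynomial ring to the coordinate ring of `W`. -/
noncomputable abbrev polyToCoordRingW : MvPolynomial (Idx l) K →ₐ[K] coordRingW K e f γ ζ :=
  (IsScalarTower.toAlgHom K (coordRingV K e f γ) (coordRingW K e f γ ζ)).comp
    (Ideal.Quotient.mkₐ K _)

omit [FiniteDimensional K L] in
variable {K e f γ ζ} in
theorem coordRingW_hom_ext {R : Type u} [CommRing R] [Algebra K R]
    {g h : coordRingW K e f γ ζ →ₐ[K] R}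
    (hgh : ∀ i, g (polyToCoordRingW K e f γ ζ (MvPolynomial.X i)) =
      h (polyToCoordRingW K e f γ ζ (MvPolynomial.X i))) : g = h := by
  have h1 : g.comp (polyToCoordRingW K e f γ ζ) = h.comp (polyToCoordRingW K e f γ ζ) :=
    MvPolynomial.algHom_ext hgh
  apply AlgHom.coe_ringHom_injective
  apply IsLocalization.ringHom_ext (Submonoid.powers (Ideal.Quotient.mk
    (Ideal.span ((hPoly K e f γ) '' (Finset.Icc 1 (e - 1) : Set ℕ))) (normPoly K f ζ)))
  apply Ideal.Quotient.ringHom_ext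
  exact RingHom.ext fun p => DFunLike.congr_fun h1 p

theorem comp_mem_WPoints {R : CommAlgCat.{u} K} (g : coordRingW K e f γ ζ →ₐ[K] R) :
    (fun i => g (polyToCoordRingW K e f γ ζ (MvPolynomial.X i))) ∈ WPoints K e f γ ζ R := by
  have h : MvPolynomial.aeval (fun i => g (polyToCoordRingW K e f γ ζ (MvPolynomial.X i))) =
      g.comp (polyToCoordRingW K e f γ ζ) := by
    ext i
    simp
  refine ⟨fun m hm => ?_, ?_⟩
  · rw [h]
    have h0 : Ideal.Quotient.mk (Ideal.span ((hPoly K e f γ) '' (Finset.Icc 1 (e - 1) : Set ℕ)))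
        (hPoly K e f γ m) = 0 :=
      Ideal.Quotient.eq_zero_iff_mem.2 (Ideal.subset_span ⟨m, hm, rfl⟩)
    change g (algebraMap (coordRingV K e f γ) _ (Ideal.Quotient.mk _ (hPoly K e f γ m))) = 0
    rw [h0, map_zero, map_zero]
  · rw [← aeval_normPoly, h]
    exact (IsLocalization.Away.algebraMap_isUnit (Ideal.Quotient.mk
      (Ideal.span ((hPoly K e f γ) '' (Finset.Icc 1 (e - 1) : Set ℕ))) (normPoly K f ζ))).map g

variable {K e f γ ζ} in
/-- The map from the coordinate ring of `W` given by a point of `W`. -/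
noncomputable def coordRingWLift {R : CommAlgCat.{u} K} {x : Idx l → R}
    (hx : x ∈ WPoints K e f γ ζ R) : coordRingW K e f γ ζ →ₐ[K] R :=
  IsLocalization.liftAlgHom (M := Submonoid.powers (Ideal.Quotient.mk
    (Ideal.span ((hPoly K e f γ) '' (Finset.Icc 1 (e - 1) : Set ℕ))) (normPoly K f ζ)))
    (f := Ideal.Quotient.liftₐ _ (MvPolynomial.aeval x) (fun p hp => by
      rw [← RingHom.mem_ker]
      refine (Ideal.span_le.2 ?_) hp
      rintro _ ⟨m, hm, rfl⟩
      exact hx.1 m hm)) (by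
    rintro ⟨_, n, rfl⟩
    rw [map_pow]
    refine IsUnit.pow n ?_
    have h := hx.2
    rw [← aeval_normPoly] at h
    exact h)

variable {K e f γ ζ} in
theorem coordRingWLift_apply {R : CommAlgCat.{u} K} {x : Idx l → R}
    (hx : x ∈ WPoints K e f γ ζ R) (i : Idx l) :
    coordRingWLift hx (polyToCoordRingW K e f γ ζ (MvPolynomial.X i)) = x i := by
  refine (IsLocalization.lift_eq _ _).trans ?_
  exact MvPolynomial.aeval_X x i

/-- `W` is represented by its coordinate ring. -/
noncomputable def corepresentableW :
    (WFunctor K e f γ ζ).CorepresentableBy (CommAlgCat.of K (coordRingW K e f γ ζ)) where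
  homEquiv {R} :=
    { toFun g := ⟨fun i => g.hom (polyToCoordRingW K e f γ ζ (MvPolynomial.X i)),
        comp_mem_WPoints K e f γ ζ g.hom⟩
      invFun x := CommAlgCat.ofHom (coordRingWLift x.2)
      left_inv g := by
        ext1
        exact coordRingW_hom_ext fun i =>
          coordRingWLift_apply (comp_mem_WPoints K e f γ ζ g.hom) i
      right_inv x := Subtype.ext (funext fun i => coordRingWLift_apply x.2 i) }
  homEquiv_comp _ _ := rfl

omit [FiniteDimensional K L] in
theorem finiteType_coordRingW : Algebra.FiniteType K (coordRingW K e f γ ζ) :=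
  Algebra.FiniteType.trans (S := coordRingV K e f γ) inferInstance
    (IsLocalization.finiteType_of_monoid_fg (Submonoid.powers (Ideal.Quotient.mk
      (Ideal.span ((hPoly K e f γ) '' (Finset.Icc 1 (e - 1) : Set ℕ))) (normPoly K f ζ))) _)

end Representability

/-! ### Arrays with equal row products -/

section RowTorus

/-- The families `u` indexed by an `e × f` array all of whose rows have the same product. -/
def rowTorus (e f : ℕ) (A : Type*) [CommGroup A] : Subgroup (Fin e × Fin f → A) where
  carrier := {u | ∀ c c', ∏ j, u (c, j) = ∏ j, u (c', j)}
  one_mem' _ _ := by simp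
  mul_mem' hu hv c c' := by simp [Finset.prod_mul_distrib, hu c c', hv c c']
  inv_mem' hu c c' := by simp [hu c c']

/-- A family with equal row products is given by the common product and by the entries outside
the first column. -/
def rowTorusEquiv (e f : ℕ) [NeZero e] (A : Type*) [CommGroup A] :
    rowTorus e (f + 1) A ≃* (Option (Fin e × Fin f) → A) where
  toFun u o := o.elim (∏ j, u.1 (0, j)) fun p => u.1 (p.1, p.2.succ)
  -- The first entry of each row is forced: the common product divided by the rest of the row.
  invFun w := ⟨fun p => Fin.cons (α := fun _ => A) (w none * (∏ j, w (some (p.1, j)))⁻¹)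
    (fun j => w (some (p.1, j))) p.2, fun c c' => by simp [Fin.prod_univ_succ]⟩
  left_inv u := by
    apply Subtype.ext
    funext ⟨c, j⟩
    induction j using Fin.cases with
    | zero =>
      have h := u.2 0 c
      rw [Fin.prod_univ_succ (fun j => u.1 (c, j))] at h
      simp [h]
    | succ j => simp
  right_inv w := by
    funext o
    cases o with
    | none => simp [Fin.prod_univ_succ]
    | some p => simp
  map_mul' u v := by
    funext o
    cases o with
    | none => simp [Finset.prod_mul_distrib]
    | some p => simp

theorem rowTorusEquiv_map (e f : ℕ) [NeZero e] {A B : Type*} [CommGroup A] [CommGroup B]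
    (φ : A →* B) (u : rowTorus e (f + 1) A) (v : rowTorus e (f + 1) B)
    (huv : ∀ p, v.1 p = φ (u.1 p)) (o : Option (Fin e × Fin f)) :
    rowTorusEquiv e f B v o = φ (rowTorusEquiv e f A u o) := by
  cases o with
  | none => simp [rowTorusEquiv, huv]
  | some p => simp [rowTorusEquiv, huv]

end RowTorus

/-! ### Splitting the norm torus over an extension containing `L` -/

section Splitting

variable {K L : Type u} [Field K] [Field L] [Algebra K L]

/-- Evaluation `R ⊗ L → R` at an embedding of `L` in `R`. -/
noncomputable def evalAt {R : Type u} [CommRing R] [Algebra K R] (ι : L →ₐ[K] R) :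
    R ⊗[K] L →ₐ[R] R :=
  Algebra.TensorProduct.lift (AlgHom.id R R) ι fun _ _ => Commute.all _ _

theorem evalAt_tmul {R : Type u} [CommRing R] [Algebra K R] (ι : L →ₐ[K] R) (r : R) (y : L) :
    evalAt ι (r ⊗ₜ y) = r * ι y := by
  simp [evalAt]

theorem tensorConj_mul (R : Type u) [CommRing R] [Algebra K R] (s t : L ≃ₐ[K] L)
    (a : R ⊗[K] L) : tensorConj R (s * t : L ≃ₐ[K] L) a = tensorConj R s (tensorConj R t a) := by
  induction a using TensorProduct.induction_on with
  | zero => simp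
  | add a b ha hb => simp only [map_add, ha, hb]
  | tmul r m => simp

theorem evalAt_tensorConj_tensorMap {R S : CommAlgCat.{u} K} (φ : R ⟶ S) (ι : L →ₐ[K] R)
    (κ : L →ₐ[K] S) (h : ∀ y, κ y = φ.hom (ι y)) (s : L →ₐ[K] L) (a : R ⊗[K] L) :
    evalAt κ (tensorConj S s (tensorMap L φ a)) = φ.hom (evalAt ι (tensorConj R s a)) := by
  induction a using TensorProduct.induction_on with
  | zero => simp
  | add a b ha hb => simp only [map_add, ha, hb]
  | tmul r m => simp [evalAt_tmul, h]

variable {l : ℕ} [Fact l.Prime] {ζ : L} [IsCyclotomicExtension {l} K L]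
  (hζ : IsPrimitiveRoot ζ l) (hGal : Nonempty ((L ≃ₐ[K] L) ≃* (ZMod l)ˣ))

/-- The map `R ⊗ L → R^Gal(L/K)` given by evaluation of the conjugates. -/
noncomputable def conjEval {R : Type u} [CommRing R] [Algebra K R] (ι : L →ₐ[K] R) :
    R ⊗[K] L →ₐ[R] ((ZMod l)ˣ → R) :=
  AlgHom.pi fun g => (evalAt ι).comp (tensorConj R (galEquiv hζ hGal g))

theorem conjEval_apply {R : Type u} [CommRing R] [Algebra K R] (ι : L →ₐ[K] R) (a : R ⊗[K] L)
    (g : (ZMod l)ˣ) : conjEval hζ hGal ι a g = evalAt ι (tensorConj R (galEquiv hζ hGal g) a) :=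
  rfl

theorem conjEval_tensorIncl_tmul_one {R : Type u} [CommRing R] [Algebra K R] (ι : L →ₐ[K] R)
    (M : IntermediateField K L) (r : R) (g : (ZMod l)ˣ) :
    conjEval hζ hGal ι (tensorIncl M R (r ⊗ₜ 1)) g = r :=
  congrFun (((conjEval hζ hGal ι).comp (tensorIncl M R)).commutes r) g

/-- In coordinates this map is the matrix of conjugates of a basis, already invertible over `L` and
hence over `R`. -/
theorem conjEval_bijective [FiniteDimensional K L] {R : Type u} [CommRing R] [Algebra K R]
    (ι : L →ₐ[K] R) : Function.Bijective (conjEval hζ hGal ι) := by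
  have hcard : Module.finrank K L = Fintype.card (ZMod l)ˣ := by
    have := IsCyclotomicExtension.isGalois {l} K L
    rw [← IsGalois.card_aut_eq_finrank, Nat.card_congr hGal.some.toEquiv,
      Nat.card_eq_fintype_card]
  let b : Module.Basis (ZMod l)ˣ K L :=
    (Module.finBasis K L).reindex (Fintype.equivFinOfCardEq hcard.symm).symm
  let D : Matrix (ZMod l)ˣ (ZMod l)ˣ R := ι.toRingHom.mapMatrix
    (Matrix.of fun g h => ((galEquiv hζ hGal g : L ≃ₐ[K] L) : L →ₐ[K] L) (b h))
  have hD : IsUnit D := by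
    refine (isUnit_conjMatrix _ (fun g h hgh => (galEquiv hζ hGal).injective ?_) b).map _
    exact AlgEquiv.ext fun x => DFunLike.congr_fun hgh x
  have h : ⇑(conjEval hζ hGal ι) =
      D.mulVec ∘ (Algebra.TensorProduct.basis R b).equivFun := by
    funext a g
    conv_lhs => rw [← (Algebra.TensorProduct.basis R b).sum_equivFun a, conjEval_apply]
    rw [map_sum, map_sum]
    refine Finset.sum_congr rfl fun h _ => ?_
    rw [Algebra.TensorProduct.basis_apply, map_smul, map_smul, Algebra.TensorProduct.map_tmul,
      evalAt_tmul, map_one, one_mul, smul_eq_mul, mul_comm]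
    rfl
  rw [h]
  exact Function.Bijective.comp
    ⟨Matrix.mulVec_injective_of_isUnit hD, Matrix.mulVec_surjective_iff_isUnit.2 hD⟩
    (LinearEquiv.bijective _)

variable {e f : ℕ} {γ : (ZMod l)ˣ}
  (hlef : l = e * f + 1) (hγ : ∀ a : (ZMod l)ˣ, a ∈ Subgroup.zpowers γ)

include hlef hγ in
-- The exponent `c + e * j` runs once through `0, …, e * f - 1`, with `c` its remainder and `j` its
-- quotient by `e`.
theorem cosetIndex_bijective : Function.Bijective
    (fun p : Fin e × Fin f => γ ^ (p.1 : ℕ) * (γ ^ e) ^ (p.2 : ℕ)) := by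
  rw [Fintype.bijective_iff_injective_and_card]
  constructor
  · rintro ⟨c, j⟩ ⟨c', j'⟩ h
    have ho := orderOf_gen hlef hγ
    have hlt : ∀ (c : Fin e) (j : Fin f), (c : ℕ) + e * j < e * f := fun c j =>
      calc (c : ℕ) + e * j < e + e * j := by omega
        _ = e * (j + 1) := by ring
        _ ≤ e * f := Nat.mul_le_mul_left _ j.2
    simp only [← pow_mul, ← pow_add] at h
    have h2 := pow_injOn_Iio_orderOf (by simp [ho, hlt]) (by simp [ho, hlt]) h
    have hc := congrArg (· % e) h2
    simp only [Nat.add_mul_mod_self_left, Nat.mod_eq_of_lt c.2, Nat.mod_eq_of_lt c'.2] at hc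
    have hj := congrArg (· / e) h2
    have he : 0 < e := (Nat.zero_le _).trans_lt c.2
    simp only [Nat.add_mul_div_left _ _ he, Nat.div_eq_of_lt c.2, Nat.div_eq_of_lt c'.2,
      zero_add] at hj
    exact Prod.ext (Fin.ext hc) (Fin.ext hj)
  · rw [Fintype.card_prod, Fintype.card_fin, Fintype.card_fin, ZMod.card_units, hlef,
      Nat.add_sub_cancel]

variable [FiniteDimensional K L]

/-- The conjugates of a unit, arranged by the cosets of `⟨γ ^ e⟩`. -/
noncomputable def splitEquiv {R : Type u} [CommRing R] [Algebra K R] (ι : L →ₐ[K] R) :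
    (R ⊗[K] L)ˣ ≃* (Fin e × Fin f → Rˣ) :=
  ((Units.mapEquiv (AlgEquiv.ofBijective _ (conjEval_bijective hζ hGal ι)).toMulEquiv).trans
    MulEquiv.piUnits).trans
      (MulEquiv.arrowCongr (Equiv.ofBijective _ (cosetIndex_bijective hlef hγ)).symm
        (MulEquiv.refl Rˣ))

theorem splitEquiv_apply {R : Type u} [CommRing R] [Algebra K R] (ι : L →ₐ[K] R)
    (u : (R ⊗[K] L)ˣ) (p : Fin e × Fin f) :
    (splitEquiv hζ hGal hlef hγ ι u p : R) =
      conjEval hζ hGal ι u (γ ^ (p.1 : ℕ) * (γ ^ e) ^ (p.2 : ℕ)) := rfl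

/-- The norm is fixed by `β` and is the product of the `β`-conjugates, so its value at any place of
row `c` is the product of that row. Scalars are the families with constant values. -/
theorem splitEquiv_mem_rowTorus {R : Type u} [CommRing R] [Algebra K R] (ι : L →ₐ[K] R)
    (u : (R ⊗[K] L)ˣ) :
    splitEquiv hζ hGal hlef hγ ι u ∈ rowTorus e f Rˣ ↔
      ∃ r : R, relNorm (fieldM K e γ ζ) R (u : R ⊗[K] L) = r ⊗ₜ 1 := by
  set N := relNorm (fieldM K e γ ζ) R (u : R ⊗[K] L) with hN
  have hrow : ∀ p : Fin e × Fin f,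
      conjEval hζ hGal ι (tensorIncl (fieldM K e γ ζ) R N)
        (γ ^ (p.1 : ℕ) * (γ ^ e) ^ (p.2 : ℕ)) =
      ((∏ j, splitEquiv hζ hGal hlef hγ ι u (p.1, j) : Rˣ) : R) := by
    intro p
    have h1 := tensorConj_tensorIncl (fieldM K e γ ζ) R
      (galEquiv hζ hGal ((γ ^ e) ^ (p.2 : ℕ)) : L ≃ₐ[K] L)
      (fun m hm => (conjM hζ hGal e γ p.2).commutes ⟨m, hm⟩) N
    rw [conjEval_apply, map_mul, tensorConj_mul, h1, hN, tensorIncl_relNorm hζ hGal hlef hγ,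
      map_prod, map_prod, Units.coe_prod]
    refine Finset.prod_congr rfl fun j _ => ?_
    rw [splitEquiv_apply, conjEval_apply, map_mul, tensorConj_mul]
  constructor
  · intro h
    -- This only provides some row, as `Fin e` is not known to be inhabited here.
    obtain ⟨p, -⟩ := (cosetIndex_bijective hlef hγ).2 1
    refine ⟨((∏ j, splitEquiv hζ hGal hlef hγ ι u (p.1, j) : Rˣ) : R), ?_⟩
    apply tensorIncl_injective
    apply (conjEval_bijective hζ hGal ι).1
    funext g
    obtain ⟨q, rfl⟩ := (cosetIndex_bijective hlef hγ).2 g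
    refine (hrow q).trans ?_
    rw [h q.1 p.1, conjEval_tensorIncl_tmul_one]
  · rintro ⟨r, hr⟩ c c'
    obtain ⟨p, -⟩ := (cosetIndex_bijective hlef hγ).2 1
    have hc : ∀ c, ((∏ j, splitEquiv hζ hGal hlef hγ ι u (c, j) : Rˣ) : R) = r := by
      intro c
      rw [← hrow (c, p.2), hr, conjEval_tensorIncl_tmul_one]
    exact Units.ext ((hc c).trans (hc c').symm)

/-- The points of `N_{L/M}⁻¹(𝔾ₘ)` over an algebra that contains `L`. -/
noncomputable def torusPointsEquiv (R : CommAlgCat.{u} K) (ι : L →ₐ[K] R) :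
    normTorusPoints (fieldM K e γ ζ) R ≃* rowTorus e f Rˣ :=
  { (splitEquiv hζ hGal hlef hγ ι).toEquiv.subtypeEquiv (fun u =>
      (mem_normTorusPoints_iff (fieldM K e γ ζ) R u).trans
        (splitEquiv_mem_rowTorus hζ hGal hlef hγ ι u).symm) with
    map_mul' := fun u v => Subtype.ext (map_mul (splitEquiv hζ hGal hlef hγ ι) u.1 v.1) }

/-- An embedding of `L` in `E` as an embedding of `L` in an `E`-algebra. -/
noncomputable def embedInAlgebra {E : Type u} [Field E] [Algebra K E] (j : L →ₐ[K] E)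
    (S : CommAlgCat.{u} E) : L →ₐ[K] (restrictBase K E).obj S :=
  { (algebraMap E S).comp j.toRingHom with
    commutes' := fun r => congrArg (algebraMap E S) (j.commutes r) }

omit [FiniteDimensional K L] in
theorem embedInAlgebra_map {E : Type u} [Field E] [Algebra K E] (j : L →ₐ[K] E)
    {S T : CommAlgCat.{u} E} (φ : S ⟶ T) (y : L) :
    embedInAlgebra j T y = ((restrictBase K E).map φ).hom (embedInAlgebra j S y) :=
  (φ.hom.commutes (j y)).symm

include hζ hGal hlef hγ in
theorem splits_of_embedding {E : Type u} [Field E] [Algebra K E] (j : L →ₐ[K] E) (hf : f ≠ 0) :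
    Nonempty (baseChangeGroup E (normTorus (fieldM K e γ ζ)) ≅ splitTorus E (1 + e * (f - 1))) := by
  have : NeZero e := ⟨by
    rintro rfl
    exact (Fact.out : l.Prime).ne_one (by simpa using hlef)⟩
  obtain ⟨n, rfl⟩ := Nat.exists_eq_succ_of_ne_zero hf
  have hcard : Fintype.card (Option (Fin e × Fin n)) = 1 + e * (n + 1 - 1) := by
    simp [add_comm]
  let ε := Fintype.equivFinOfCardEq hcard
  let Φ (S : CommAlgCat.{u} E) :
      normTorusPoints (fieldM K e γ ζ) ((restrictBase K E).obj S) ≃*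
        (Fin (1 + e * (n + 1 - 1)) → ((restrictBase K E).obj S)ˣ) :=
    ((torusPointsEquiv hζ hGal hlef hγ _ (embedInAlgebra j S)).trans (rowTorusEquiv e n _)).trans
      (MulEquiv.arrowCongr ε (MulEquiv.refl _))
  refine ⟨NatIso.ofComponents (fun S => MulEquiv.toCommGrpIso (Φ S)) ?_⟩
  intro S T φ
  ext u : 2
  funext i
  let ψ : ((restrictBase K E).obj S)ˣ →* ((restrictBase K E).obj T)ˣ :=
    Units.map (((restrictBase K E).map φ).hom : _ →* _)
  refine rowTorusEquiv_map e n ψ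
    (torusPointsEquiv hζ hGal hlef hγ _ (embedInAlgebra j S) u) _ (fun p => ?_) (ε.symm i)
  apply Units.ext
  -- Naturality holds because the embeddings of `L` into all `E`-algebras factor through the same
  -- `j`.
  exact evalAt_tensorConj_tensorMap ((restrictBase K E).map φ) _ _ (embedInAlgebra_map j φ) _ _

end Splitting

theorem theorem1p6 {K L : Type u} [Field K] [Field L] [Algebra K L] [FiniteDimensional K L]
    (l e f : ℕ) [Fact l.Prime] (hodd : Odd l) (hf : 2 ≤ f) (hlef : l = e * f + 1)
    (hcharf : ¬ ringChar K ∣ f.factorial) (hcharl : ¬ ringChar K ∣ l)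
    [IsCyclotomicExtension {l} K L] (ζ : L) (hζ : IsPrimitiveRoot ζ l)
    (hGal : Nonempty ((L ≃ₐ[K] L) ≃* (ZMod l)ˣ))
    (γ : (ZMod l)ˣ) (hγ : ∀ a : (ZMod l)ˣ, a ∈ Subgroup.zpowers γ) :
    -- `W` is the set of points of `V` that are invertible for the `(-1)`-composition
    (∀ (R : CommAlgCat.{u} K) (x : Idx l → R), x ∈ WPoints K e f γ ζ R ↔
      x ∈ VPoints K e f γ R ∧
        ∃ y ∈ VPoints K e f γ R, dComp f (-1) x y = oneVec l f R) ∧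
    -- `W` is the affine variety with the given finitely generated coordinate ring
    Algebra.FiniteType K (coordRingW K e f γ ζ) ∧
    (∃ c : (WFunctor K e f γ ζ).CorepresentableBy (CommAlgCat.of K (coordRingW K e f γ ζ)),
      ∀ (R : CommAlgCat.{u} K) (g : CommAlgCat.of K (coordRingW K e f γ ζ) ⟶ R) (i : Idx l),
        (c.homEquiv g).1 i = g.hom (algebraMap (coordRingV K e f γ) (coordRingW K e f γ ζ)
          (Ideal.Quotient.mk _ (MvPolynomial.X i)))) ∧
    -- `N_{L/M}⁻¹(𝔾ₘ)` is an algebraic torus, split of dimension `1 + e (f - 1)` over `K̄`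
    IsAlgebraicTorus (normTorus (fieldM K e γ ζ)) (1 + e * (f - 1)) ∧
    -- `W` with the `(-1)`-composition is an algebraic group, isomorphic to this torus
    ∃ (G : CommAlgCat.{u} K ⥤ CommGrpCat.{u})
      (ε : (G ⋙ forget CommGrpCat.{u}) ≅ WFunctor K e f γ ζ),
      (∀ (R : CommAlgCat.{u} K) (a b : G.obj R),
        (ε.hom.app R (a * b : G.obj R)).1 =
          dComp f (-1) (ε.hom.app R a).1 (ε.hom.app R b).1) ∧
      IsAlgebraicGroup G ∧
      Nonempty (G ≅ normTorus (fieldM K e γ ζ)) := by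
  have hf0 : f ≠ 0 := by omega
  refine ⟨fun R x => mem_WPoints_iff_exists_inverse hζ hGal hlef hγ hf0 x,
    finiteType_coordRingW K e f γ ζ, ⟨corepresentableW K e f γ ζ, fun _ _ _ => rfl⟩, ?_, ?_⟩
  · refine ⟨⟨_, finiteType_coordRingW K e f γ ζ, ⟨(corepresentableW K e f γ ζ).ofIso
      (torusIsoW hζ hGal hlef hγ).symm⟩⟩, ?_⟩
    intro E _ _ _
    have := IsAlgClosure.isAlgClosed K (K := E)
    exact splits_of_embedding hζ hGal hlef hγ (IsAlgClosed.lift : L →ₐ[K] E) hf0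
  -- The group structure on `W` is transported from the torus along `x ↦ α_x`, so the group
  -- isomorphism is the identity and the content lies in `torusIsoW_mul`.
  · exact ⟨normTorus (fieldM K e γ ζ), torusIsoW hζ hGal hlef hγ,
      torusIsoW_mul hζ hGal hlef hγ, ⟨_, finiteType_coordRingW K e f γ ζ,
        ⟨(corepresentableW K e f γ ζ).ofIso (torusIsoW hζ hGal hlef hγ).symm⟩⟩, ⟨Iso.refl _⟩⟩
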